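/- **Setting.** Let $X_i\in\mathbb R^p$, $Z_i\in\mathbb R^q$ ($i\ge 1$) be non-random row vectors, let $\alpha_0\in\mathbb R^p$ and $\beta_0\in\Theta_\beta$ with $\Theta_\beta\subset\mathbb R^q$ bounded, and let $$Y_i=X_i^T\alpha_0+e^{\frac12 Z_i^T\beta_0}\epsilon_i,\qquad i=1,\dots,n .$$ Let $X,Z$ be the design matrices with $n$ rows, $Y=(Y_1,\dots,Y_n)^T$, $Z^*=(Z,\mathbf 1_n)$ with rows $Z_i^*$, $c_0=\mathbb E[\log\epsilon_1^2]$, $\beta_0^*=(\beta_0,c_0)$, $D_n(\beta)=\mathrm{diag}(e^{\frac12Z_i^T\beta})_{i\le n}$, $L_n(\alpha)=(\log (Y_i-X_i^T\alpha)^2)_{i\le n}$, $T(\alpha)=\mathrm{diag}(\alpha_j^{-2})_{j\le p}$, $S(\beta^*)=\mathrm{diag}((\beta_j^{*})^{-2})_{j\le q+1}$. For diagonal tuning matrices $\Psi_n,\Omega_n^*\succeq0$, $\Lambda_n=\mathrm{diag}(\lambda_{nj})\succ0$, $\Gamma_n^*=\mathrm{diag}(\gamma_{nj})\succeq0$, define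 $\tilde\alpha_n^{(0)}=(X^TX+\Psi_n)^{-1}X^TY$, $\tilde\beta_n^{*(0)}=(Z^{*T}Z^*+\Omega_n^*)^{-1}Z^{*T}L_n(\tilde\alpha_n^{(0)})$ and, for $k\ge0$, with $\tilde\beta_n^{(k)}$ the first $q$ components of $\tilde\beta_n^{*(k)}$, $$\tilde\alpha_n^{(k+1)}=\bigl(X^TD_n^{-2}(\tilde\beta_n^{(k)})X+\Lambda_nT(\tilde\alpha_n^{(k)})\bigr)^{-1}X^TD_n^{-2}(\tilde\beta_n^{(k)})Y,$$ $$\tilde\beta_n^{*(k+1)}=\bigl(Z^{*T}Z^*+\Gamma_n^*S(\tilde\beta_n^{*(k)})\bigr)^{-1}Z^{*T}L_n(\tilde\alpha_n^{(k+1)}).$$ Each iteration is read in the equivalent form that does not divide by components of the current estimate (for instance $\tilde\alpha_n^{(k+1)}=A(AX^TD_n^{-2}(\tilde\beta_n^{(k)})XA+\Lambda_n)^{-1}AX^TD_n^{-2}(\tilde\beta_n^{(k)})Y$ with $A=\mathrm{diag}(\tilde\alpha_n^{(k)})$), so that a component that is exactly $0$ stays $0$. The subscript $\circ$ denotes the subvector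 of the components at which $\alpha_0$, respectively $\beta_0^*$, is zero, $\|\cdot\|$ is the Euclidean norm, and $0/0=0$. **Assumptions.** * (A1) $X^TX/n$, $X^TD_n^2(\beta_0)X/n$, $X^TD_n^{-2}(\beta_0)X/n$, $Z^TZ/n$ and $Z^{*T}Z^*/n$ converge to positive definite matrices, and there are $K_X,K_Z>1$ and $N$ such that for all $n\ge N$ all eigenvalues of $X^TD_n^{-2}(\beta)X/n$, $\beta\in\Theta_\beta$, lie in $[1/K_X,K_X]$ and all eigenvalues of $Z^{*T}Z^*/n$ lie in $[1/K_Z,K_Z]$. * (A2) $\sup_i\|X_i\|<\infty$ and $\sup_i\|Z^*_i\|<\infty$. * (A3) $\epsilon_1,\epsilon_2,\dots$ are i.i.d. with mean $0$, variance $1$ and $\mathbb E|\epsilon_1|^{-s}<\infty$ for all $s\in(-\infty,1)$. * (A4) For each $k\ge0$ there are $a\in(0,1)$ and $N$ with $\sup_{n>N}\sup_{i\le n}\mathbb E\bigl|e^{\frac12Z_i^T\beta_0}\epsilon_i-X_i^T(\tilde\alpha_n^{(k)}-\alpha_0)\bigr|^{-a}<\infty$. **Theorem.** Assume (A1)–(A4),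 $\Psi_n/\sqrt n\to0$ and $\Lambda_n/\sqrt n\to0$. 1. If $\min_{1\le j\le p}\lambda_{nj}\to\infty$, then for every $k\ge0$, $\ \|\tilde\alpha^{(k+1)}_{n\circ}\|/\|\tilde\alpha^{(k)}_{n\circ}\|\to0$ in probability as $n\to\infty$. 2. If $\Omega_n^*/\sqrt n\to0$, $\Gamma_n^*/\sqrt n\to0$ and $\min_{1\le j\le q+1}\gamma_{nj}/n^c\to\infty$ for some $c>0$, then for every $k\ge0$, $\ \|\tilde\beta^{*(k+1)}_{n\circ}\|/\|\tilde\beta^{*(k)}_{n\circ}\|\to0$ in probability as $n\to\infty$. 3. If $\mathbb E|\epsilon_1|^{-(1+\tau)}<\infty$ for some $\tau>0$, then in 2 the condition $\min_j\gamma_{nj}/n^c\to\infty$ can be replaced by $\min_j\gamma_{nj}\to\infty$. -/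

import Mathlib

open Filter Topology MeasureTheory ProbabilityTheory Matrix

namespace HetAR

noncomputable section

/-! ### Ridge and adaptive ridge maps -/

/-- Ridge estimator with diagonal penalty `pen`: `(XᵀX + diag pen)⁻¹ Xᵀ y`. -/
def ridge {n : ℕ} {m : Type*} [Fintype m] [DecidableEq m]
    (X : Matrix (Fin n) m ℝ) (pen : m → ℝ) (y : Fin n → ℝ) : m → ℝ :=
  (Xᵀ * X + diagonal pen)⁻¹ *ᵥ (Xᵀ *ᵥ y)

/-- Adaptive ridge step with row weights `w`, tuning parameters `pen` and current estimate `a`: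
the minimiser of `∑ i, w i * (y - X b) i ^ 2 + ∑ j, pen j * (a j)⁻² * (b j) ^ 2` over `b`, written
without dividing by the entries of `a`. When no entry of `a` vanishes it is
`(Xᵀ W X + diag (pen j * (a j)⁻²))⁻¹ Xᵀ W y` (see `adaptiveRidge_eq`). An entry `a j = 0`
amounts to an infinite penalty, so that the `j`-th entry of the new estimate is `0`. -/
def adaptiveRidge {n : ℕ} {m : Type*} [Fintype m] [DecidableEq m]
    (X : Matrix (Fin n) m ℝ) (w : Fin n → ℝ) (pen a : m → ℝ) (y : Fin n → ℝ) : m → ℝ :=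
  diagonal a *ᵥ ((diagonal a * (Xᵀ * diagonal w * X) * diagonal a + diagonal pen)⁻¹ *ᵥ
    (diagonal a *ᵥ (Xᵀ *ᵥ (diagonal w *ᵥ y))))

theorem adaptiveRidge_eq {n : ℕ} {m : Type*} [Fintype m] [DecidableEq m]
    (X : Matrix (Fin n) m ℝ) (w : Fin n → ℝ) (pen a : m → ℝ) (y : Fin n → ℝ)
    (ha : ∀ j, a j ≠ 0) :
    adaptiveRidge X w pen a y =
      (Xᵀ * diagonal w * X + diagonal pen * diagonal (fun j => ((a j) ^ 2)⁻¹))⁻¹ *ᵥ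
        (Xᵀ *ᵥ (diagonal w *ᵥ y)) := by
  have hdet : IsUnit (diagonal a).det := by
    rw [det_diagonal]
    exact (Finset.prod_ne_zero_iff.mpr fun j _ => ha j).isUnit
  have h : diagonal a * (Xᵀ * diagonal w * X) * diagonal a + diagonal pen =
      diagonal a * (Xᵀ * diagonal w * X + diagonal pen * diagonal (fun j => ((a j) ^ 2)⁻¹)) *
        diagonal a := by
    rw [Matrix.mul_add, Matrix.add_mul]
    congr 1
    simp only [diagonal_mul_diagonal]
    congr 1
    funext j
    have := ha j
    field_simp
  unfold adaptiveRidge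
  rw [h, Matrix.mul_inv_rev, Matrix.mul_inv_rev]
  simp only [mulVec_mulVec]
  simp only [Matrix.mul_assoc]
  rw [Matrix.mul_nonsing_inv_cancel_left _ _ hdet]
  rw [Matrix.nonsing_inv_mul_cancel_left _ _ hdet]

/-! ### The model -/

/-- The first `n` terms of a sequence of row vectors, as an `n × m` design matrix. -/
def designMatrix {m : Type*} (X : ℕ → m → ℝ) (n : ℕ) : Matrix (Fin n) m ℝ :=
  Matrix.of fun i j => X i j

/-- The row `(Z_i, 1)`. -/
def withOne {q : ℕ} (z : Fin q → ℝ) : Fin (q + 1) → ℝ := Fin.snoc (α := fun _ => ℝ) z 1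

/-- The sequence of rows of `Z* = (Z, 1)`. -/
def zStar {q : ℕ} (Z : ℕ → Fin q → ℝ) : ℕ → Fin (q + 1) → ℝ := fun i => withOne (Z i)

/-- The diagonal of `D_n(β)^t`, namely `exp(t * Z_iᵀβ / 2)`. -/
def scalePow {q : ℕ} (Z : ℕ → Fin q → ℝ) (β : Fin q → ℝ) (t : ℝ) (n : ℕ) : Fin n → ℝ :=
  fun i => Real.exp (t * (1 / 2 * (Z i ⬝ᵥ β)))

/-- `n⁻¹ Xᵀ D_n(β)^t X`; for `t = 0` this is `n⁻¹ XᵀX`. -/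
def weightedGram {m : Type*} {q : ℕ} (X : ℕ → m → ℝ) (Z : ℕ → Fin q → ℝ)
    (β : Fin q → ℝ) (t : ℝ) (n : ℕ) : Matrix m m ℝ :=
  (n : ℝ)⁻¹ • ((designMatrix X n)ᵀ * diagonal (scalePow Z β t n) * designMatrix X n)

/-- `n⁻¹ XᵀX`. -/
def gram {m : Type*} (X : ℕ → m → ℝ) (n : ℕ) : Matrix m m ℝ :=
  (n : ℝ)⁻¹ • ((designMatrix X n)ᵀ * designMatrix X n)

/-- Response `Y_i = X_iᵀ α + exp(Z_iᵀ β / 2) ε_i`. -/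
def response {Ω : Type*} {p q : ℕ} (X : ℕ → Fin p → ℝ) (Z : ℕ → Fin q → ℝ)
    (α : Fin p → ℝ) (β : Fin q → ℝ) (ε : ℕ → Ω → ℝ) (i : ℕ) (ω : Ω) : ℝ :=
  X i ⬝ᵥ α + Real.exp (1 / 2 * (Z i ⬝ᵥ β)) * ε i ω

/-- `c₀ = E[log ε²]`. -/
def logNoiseMean {Ω : Type*} [MeasurableSpace Ω] (P : Measure Ω) (ε : ℕ → Ω → ℝ) : ℝ :=
  ∫ ω, Real.log ((ε 0 ω) ^ 2) ∂P

/-- `β*₀ = (β₀, c₀)`. -/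
def betaStar {Ω : Type*} [MeasurableSpace Ω] {q : ℕ} (P : Measure Ω) (ε : ℕ → Ω → ℝ)
    (β : Fin q → ℝ) : Fin (q + 1) → ℝ :=
  Fin.snoc (α := fun _ => ℝ) β (logNoiseMean P ε)

/-! ### The estimators -/

/-- Diagonals of the tuning matrices `Ψ_n`, `Ω*_n`, `Λ_n`, `Γ*_n`. -/
structure Tuning (p q : ℕ) where
  psi : ℕ → Fin p → ℝ
  omega : ℕ → Fin (q + 1) → ℝ
  lam : ℕ → Fin p → ℝ
  gam : ℕ → Fin (q + 1) → ℝ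

/-- Vector of log squared residuals `L_n(α) = (log (y_i - X_iᵀ α)²)_i`. -/
def logRes {p n : ℕ} (X : ℕ → Fin p → ℝ) (y : Fin n → ℝ) (α : Fin p → ℝ) : Fin n → ℝ :=
  fun i => Real.log ((y i - X i ⬝ᵥ α) ^ 2)

/-- The `k`-th iterate `(α̃_n^(k), β̃*_n^(k))` computed from the observations `y`. -/
def iterate {p q : ℕ} (X : ℕ → Fin p → ℝ) (Z : ℕ → Fin q → ℝ) (T : Tuning p q)
    {n : ℕ} (y : Fin n → ℝ) : ℕ → (Fin p → ℝ) × (Fin (q + 1) → ℝ)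
  | 0 =>
    let a := ridge (designMatrix X n) (T.psi n) y
    (a, ridge (designMatrix (zStar Z) n) (T.omega n) (logRes X y a))
  | k + 1 =>
    let s := iterate X Z T y k
    let a := adaptiveRidge (designMatrix X n) (scalePow Z (Fin.init s.2) (-2) n) (T.lam n) s.1 y
    (a, adaptiveRidge (designMatrix (zStar Z) n) (fun _ => 1) (T.gam n) s.2 (logRes X y a))

/-- `α̃_n^(k)` as a random vector. -/
def alphaHat {Ω : Type*} {p q : ℕ} (X : ℕ → Fin p → ℝ) (Z : ℕ → Fin q → ℝ)
    (α₀ : Fin p → ℝ) (β₀ : Fin q → ℝ) (ε : ℕ → Ω → ℝ) (T : Tuning p q)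
    (k n : ℕ) (ω : Ω) : Fin p → ℝ :=
  (iterate X Z T (fun i : Fin n => response X Z α₀ β₀ ε i ω) k).1

/-- `β̃*_n^(k)` as a random vector. -/
def betaStarHat {Ω : Type*} {p q : ℕ} (X : ℕ → Fin p → ℝ) (Z : ℕ → Fin q → ℝ)
    (α₀ : Fin p → ℝ) (β₀ : Fin q → ℝ) (ε : ℕ → Ω → ℝ) (T : Tuning p q)
    (k n : ℕ) (ω : Ω) : Fin (q + 1) → ℝ :=
  (iterate X Z T (fun i : Fin n => response X Z α₀ β₀ ε i ω) k).2

/-- Euclidean norm of the subvector of `v` at the positions where the true parameter `θ` is `0`. -/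
def zeroNorm {m : Type*} [Fintype m] (θ v : m → ℝ) : ℝ :=
  √(∑ j with θ j = 0, (v j) ^ 2)

/-! ### Assumptions -/

/-- Regularity of the designs: limits of the Gram matrices, and uniform eigenvalue bounds
(`β` ranges over the parameter domain `Θ`). -/
structure DesignRegular {p q : ℕ} (X : ℕ → Fin p → ℝ) (Z : ℕ → Fin q → ℝ)
    (β₀ : Fin q → ℝ) (Θ : Set (Fin q → ℝ)) : Prop where
  limX : ∃ S : Matrix (Fin p) (Fin p) ℝ, S.PosDef ∧ Tendsto (gram X) atTop (𝓝 S)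
  limX_plus : ∃ S : Matrix (Fin p) (Fin p) ℝ, S.PosDef ∧
    Tendsto (weightedGram X Z β₀ 2) atTop (𝓝 S)
  limX_minus : ∃ S : Matrix (Fin p) (Fin p) ℝ, S.PosDef ∧
    Tendsto (weightedGram X Z β₀ (-2)) atTop (𝓝 S)
  limZ : ∃ S : Matrix (Fin q) (Fin q) ℝ, S.PosDef ∧ Tendsto (gram Z) atTop (𝓝 S)
  limZStar : ∃ S : Matrix (Fin (q + 1)) (Fin (q + 1)) ℝ, S.PosDef ∧
    Tendsto (gram (zStar Z)) atTop (𝓝 S)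
  eigX : ∃ K : ℝ, 1 < K ∧ ∃ N : ℕ, ∀ n ≥ N, ∀ β ∈ Θ,
    ∀ μ ∈ spectrum ℝ (weightedGram X Z β (-2) n), 1 / K ≤ μ ∧ μ ≤ K
  eigZStar : ∃ K : ℝ, 1 < K ∧ ∃ N : ℕ, ∀ n ≥ N,
    ∀ μ ∈ spectrum ℝ (gram (zStar Z) n), 1 / K ≤ μ ∧ μ ≤ K

/-- Uniformly bounded rows. -/
structure BoundedDesign {p q : ℕ} (X : ℕ → Fin p → ℝ) (Z : ℕ → Fin q → ℝ) : Prop where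
  bddX : Bornology.IsBounded (Set.range X)
  bddZStar : Bornology.IsBounded (Set.range (zStar Z))

/-- `E|ε₁|^t` as an extended nonnegative number, with `0 ^ t = ∞` for `t < 0`. -/
def absMoment {Ω : Type*} [MeasurableSpace Ω] (P : Measure Ω) (f : Ω → ℝ) (t : ℝ) : ENNReal :=
  ∫⁻ ω, (ENNReal.ofReal |f ω|) ^ t ∂P

/-- I.i.d. standardised noise with `E|ε₁|^(-s) < ∞` for every `s ∈ (-∞, 1)`. -/
structure NoiseRegular {Ω : Type*} [MeasurableSpace Ω] (P : Measure Ω) (ε : ℕ → Ω → ℝ) :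
    Prop where
  meas : ∀ i, Measurable (ε i)
  indep : iIndepFun ε P
  ident : ∀ i, IdentDistrib (ε i) (ε 0) P P
  mean : ∫ ω, ε 0 ω ∂P = 0
  var : variance (ε 0) P = 1
  moments : ∀ s : ℝ, s < 1 → absMoment P (ε 0) (-s) < ⊤

/-- Uniform inverse moments, of some order in `(0, 1)`, of the residuals at every iterate. -/
def ResidualInverseMoments {Ω : Type*} [MeasurableSpace Ω] {p q : ℕ} (P : Measure Ω)
    (X : ℕ → Fin p → ℝ) (Z : ℕ → Fin q → ℝ) (α₀ : Fin p → ℝ) (β₀ : Fin q → ℝ)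
    (ε : ℕ → Ω → ℝ) (T : Tuning p q) : Prop :=
  ∀ k : ℕ, ∃ a : ℝ, 0 < a ∧ a < 1 ∧ ∃ N : ℕ,
    (⨆ n : ℕ, ⨆ _ : N < n, ⨆ i : Fin n,
      absMoment P (fun ω => Real.exp (1 / 2 * (Z i ⬝ᵥ β₀)) * ε i ω
        - X i ⬝ᵥ (alphaHat X Z α₀ β₀ ε T k n ω - α₀)) (-a)) < ⊤

/-- `diag(d_n) / √n → 0`. -/
def SqrtNegligible {m : Type*} [DecidableEq m] (d : ℕ → m → ℝ) : Prop :=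
  Tendsto (fun n : ℕ => (√(n : ℝ))⁻¹ • diagonal (d n)) atTop (𝓝 (0 : Matrix m m ℝ))

end

end HetAR

namespace HetAR

/-! ### Quadratic forms and the normal equations -/

section LinearAlgebra

variable {m : Type*} [Fintype m]

/-! Every iterate is a weighted adaptive ridge estimate `b` computed from a current estimate `a`.
Writing `b j = a j * u j`, the normal equations read `a j * (M (b - θ)) j + pen j * u j = a j * r
j`, where `M` is the weighted Gram matrix, of order `n`, and `r` is the score of the errors. They
have two consequences.

Rate: pair the equations with `b - θ`. Where `θ j = 0` the penalty has the favourable sign; where `θ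
j ≠ 0` the entry `a j` stays away from `0`, so the penalty costs at most order `√n`. A score of
order `n ^ (1 - s/2)` with `s ≤ 1` thus yields an error of order `n ^ (-s/2)`, and this rate passes
from `a` to `b`.

Shrinkage: where `θ j = 0`, `b j = a j * (a j * (r - M (b - θ)) j / pen j)`. The inner `a j` is
itself an estimation error, of order `n ^ (-s/2)`, and the bracket is of order `n ^ (1 - s/2)`.
Hence the ratio of the zero blocks is of order `n ^ (1 - s) / min pen`.

For the location `s = 1`. The weights depend on the random scale estimate, so the score is bounded
uniformly over bounded scale parameters by Cauchy-Schwarz for the positive semidefinite kernel `exp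
(x ⬝ y)` (`sq_sum_mul_exp_le`, `WhiteNoise.exists_score_bound`). Only boundedness of the scale
estimates is needed (`betaStarHat_boundedInProb`), not their consistency.

For the scale, the score is a white noise sum of order `√n` plus the effect of replacing errors by
residuals inside the logarithm. The latter is `n ^ (1 - s/2)` when the noise has an inverse moment
of some order `s' > s` (`abs_log_residual_sub_le`, `scale_stepBounds`). Moments of order below `1`
allow any `s < 1`, at the price of penalties growing like a power of `n`; a moment of order above
`1` allows `s = 1`.

The probabilistic part is reduced to deterministic inequalities on events where finitely many
statistics are bounded (`BoundedInProb`). The norm on `m → ℝ` is the supremum norm, whence the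
cardinality factors. -/

theorem abs_dotProduct_le (u v : m → ℝ) : |u ⬝ᵥ v| ≤ Fintype.card m * (‖u‖ * ‖v‖) := by
  calc |u ⬝ᵥ v| ≤ ∑ j, |u j * v j| := Finset.abs_sum_le_sum_abs _ _
    _ ≤ ∑ _j : m, ‖u‖ * ‖v‖ := by
        refine Finset.sum_le_sum fun j _ => ?_
        rw [abs_mul]
        exact mul_le_mul (norm_le_pi_norm u j) (norm_le_pi_norm v j) (abs_nonneg _) (norm_nonneg _)
    _ = _ := by simp

/-- Matrices close to a positive definite matrix are uniformly coercive. -/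
theorem eventually_coercive_of_tendsto {S : Matrix m m ℝ} (hS : S.PosDef)
    {G : ℕ → Matrix m m ℝ} (hG : Tendsto G atTop (𝓝 S)) :
    ∃ κ : ℝ, 0 < κ ∧ ∀ᶠ n in atTop, ∀ v : m → ℝ, κ * ‖v‖ ^ 2 ≤ v ⬝ᵥ (G n *ᵥ v) := by
  have hK : IsCompact (Metric.sphere (0 : m → ℝ) 1) := isCompact_sphere _ _
  have hcont : Continuous fun z : Matrix m m ℝ × (m → ℝ) => z.2 ⬝ᵥ (z.1 *ᵥ z.2) := by
    fun_prop
  obtain ⟨κ, hκ, hlow⟩ : ∃ κ : ℝ, 0 < κ ∧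
      ∀ v ∈ Metric.sphere (0 : m → ℝ) 1, κ < v ⬝ᵥ (S *ᵥ v) := by
    -- The sphere is empty exactly when `m` is, and any positive constant then works.
    rcases (Metric.sphere (0 : m → ℝ) 1).eq_empty_or_nonempty with h | h
    · exact ⟨1, one_pos, by simp [h]⟩
    · obtain ⟨v₀, hv₀, hmin⟩ := hK.exists_isMinOn h
        (f := fun v : m → ℝ => v ⬝ᵥ (S *ᵥ v)) (by fun_prop)
      have hv₀' : v₀ ≠ 0 := by
        rintro rfl
        simp at hv₀
      have hp : 0 < v₀ ⬝ᵥ (S *ᵥ v₀) := by simpa using hS.dotProduct_mulVec_pos hv₀'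
      exact ⟨_, half_pos hp, fun v hv => (half_lt_self hp).trans_le (hmin hv)⟩
  refine ⟨κ, hκ, ?_⟩
  -- The strict bound is an open condition on (matrix, vector); compactness of the sphere gives one
  -- neighbourhood of `S` that serves all unit vectors.
  have hev := hG.eventually (hK.eventually_forall_of_forall_eventually
    (P := fun A v => κ < v ⬝ᵥ (A *ᵥ v)) fun v hv =>
      hcont.continuousAt.eventually (lt_mem_nhds (hlow v hv)))
  filter_upwards [hev] with n hn v
  by_cases hv : v = 0
  · simp [hv]
  have hv0 : ‖v‖ ≠ 0 := norm_ne_zero_iff.2 hv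
  have h1 := (hn (‖v‖⁻¹ • v) (by simp [norm_smul, hv0])).le
  rw [mulVec_smul, smul_dotProduct, dotProduct_smul, smul_eq_mul, smul_eq_mul] at h1
  calc κ * ‖v‖ ^ 2 ≤ (‖v‖⁻¹ * (‖v‖⁻¹ * v ⬝ᵥ G n *ᵥ v)) * ‖v‖ ^ 2 := by gcongr
    _ = _ := by field_simp

variable {n : ℕ}

omit [Fintype m] in
theorem transpose_mul_diagonal_mulVec_apply (X : Matrix (Fin n) m ℝ)
    (w e : Fin n → ℝ) (j : m) :
    (Xᵀ *ᵥ (diagonal w *ᵥ e)) j = ∑ i, X i j * (w i * e i) := by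
  simp [mulVec, dotProduct, diagonal_apply]

theorem gramForm_mulVec [DecidableEq m] (X : Matrix (Fin n) m ℝ) (w : Fin n → ℝ) (v : m → ℝ) :
    (Xᵀ * diagonal w * X) *ᵥ v = Xᵀ *ᵥ (diagonal w *ᵥ (X *ᵥ v)) := by
  simp only [mulVec_mulVec, Matrix.mul_assoc]

theorem dotProduct_gramForm_mulVec [DecidableEq m] (X : Matrix (Fin n) m ℝ) (w : Fin n → ℝ)
    (v : m → ℝ) :
    v ⬝ᵥ ((Xᵀ * diagonal w * X) *ᵥ v) = ∑ i, w i * (X *ᵥ v) i ^ 2 := by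
  rw [gramForm_mulVec, dotProduct_mulVec, vecMul_transpose, dotProduct]
  refine Finset.sum_congr rfl fun i _ => ?_
  rw [mulVec_diagonal]
  ring

theorem norm_transpose_mulVec_le (X : Matrix (Fin n) m ℝ) {C : ℝ} (hC : 0 ≤ C)
    (hX : ∀ i j, |X i j| ≤ C) (e : Fin n → ℝ) : ‖Xᵀ *ᵥ e‖ ≤ C * ∑ i, |e i| := by
  refine (pi_norm_le_iff_of_nonneg
    (mul_nonneg hC (Finset.sum_nonneg fun i _ => abs_nonneg _))).2 fun j => ?_
  rw [Real.norm_eq_abs, mulVec, dotProduct, Finset.mul_sum]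
  refine (Finset.abs_sum_le_sum_abs _ _).trans (Finset.sum_le_sum fun i _ => ?_)
  rw [abs_mul, transpose_apply]
  exact mul_le_mul_of_nonneg_right (hX i j) (abs_nonneg _)

theorem norm_gramForm_mulVec_le [DecidableEq m] (X : Matrix (Fin n) m ℝ) {C W : ℝ} (hC : 0 ≤ C)
    (hW : 0 ≤ W) (hX : ∀ i j, |X i j| ≤ C) (w : Fin n → ℝ) (hw : ∀ i, |w i| ≤ W) (v : m → ℝ) :
    ‖(Xᵀ * diagonal w * X) *ᵥ v‖ ≤ C * W * (Fintype.card m * C) * n * ‖v‖ := by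
  rw [gramForm_mulVec]
  refine (norm_transpose_mulVec_le X hC hX _).trans ?_
  have h : ∀ i, |(diagonal w *ᵥ (X *ᵥ v)) i| ≤ W * (Fintype.card m * (C * ‖v‖)) := fun i => by
    rw [mulVec_diagonal, abs_mul]
    refine mul_le_mul (hw i) ?_ (abs_nonneg _) hW
    refine (abs_dotProduct_le _ _).trans ?_
    gcongr
    exact (pi_norm_le_iff_of_nonneg hC).2 fun j => hX i j
  calc _ ≤ C * ∑ _i : Fin n, W * (Fintype.card m * (C * ‖v‖)) := by
        gcongr with i; exact h i
    _ = _ := by simp; ring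

/-- The weights will depend on a random scale estimate; a lower bound on them transfers coercivity
from the unweighted design. -/
theorem coercive_gramForm [DecidableEq m] (X : Matrix (Fin n) m ℝ) {κ δ : ℝ} (hδ : 0 ≤ δ)
    (w : Fin n → ℝ) (hw : ∀ i, δ ≤ w i)
    (hX : ∀ v : m → ℝ, κ * ‖v‖ ^ 2 ≤ v ⬝ᵥ ((Xᵀ * X) *ᵥ v)) (v : m → ℝ) :
    δ * κ * ‖v‖ ^ 2 ≤ v ⬝ᵥ ((Xᵀ * diagonal w * X) *ᵥ v) := by
  have h1 : v ⬝ᵥ ((Xᵀ * X) *ᵥ v) = ∑ i, (X *ᵥ v) i ^ 2 := by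
    have := dotProduct_gramForm_mulVec X (fun _ => 1) v
    simpa using this
  rw [dotProduct_gramForm_mulVec, mul_assoc]
  refine (mul_le_mul_of_nonneg_left ((hX v).trans_eq h1) hδ).trans ?_
  rw [Finset.mul_sum]
  exact Finset.sum_le_sum fun i _ => mul_le_mul_of_nonneg_right (hw i) (sq_nonneg _)

variable [DecidableEq m]

theorem ridge_eq_adaptiveRidge (X : Matrix (Fin n) m ℝ) (pen : m → ℝ) (y : Fin n → ℝ) :
    ridge X pen y = adaptiveRidge X (fun _ => 1) pen (fun _ => 1) y := by
  simp [ridge, adaptiveRidge]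

/-- On a kernel vector both the Gram part and the penalty part of the quadratic form vanish, and
each coordinate is controlled by one of them. -/
theorem isUnit_det_of_coercive {M : Matrix m m ℝ} {κ : ℝ} (hκ : 0 < κ)
    (hM : ∀ v : m → ℝ, κ * ‖v‖ ^ 2 ≤ v ⬝ᵥ (M *ᵥ v)) {pen a : m → ℝ} (hpen : ∀ j, 0 ≤ pen j)
    (h : ∀ j, a j ≠ 0 ∨ 0 < pen j) :
    IsUnit (diagonal a * M * diagonal a + diagonal pen).det := by
  rw [isUnit_iff_ne_zero]
  intro hdet
  obtain ⟨v, hv, hv0⟩ := exists_mulVec_eq_zero_iff.2 hdet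
  have hq : v ⬝ᵥ ((diagonal a * M * diagonal a + diagonal pen) *ᵥ v) =
      (diagonal a *ᵥ v) ⬝ᵥ (M *ᵥ (diagonal a *ᵥ v)) + ∑ j, pen j * v j ^ 2 := by
    rw [add_mulVec, dotProduct_add]
    congr 1
    · rw [Matrix.mul_assoc, ← mulVec_mulVec, ← mulVec_mulVec, dotProduct_mulVec]
      congr 1
      funext j
      rw [vecMul_diagonal, mulVec_diagonal, mul_comm]
    · rw [dotProduct]
      refine Finset.sum_congr rfl fun j _ => ?_
      rw [mulVec_diagonal]
      ring
  rw [hv0, dotProduct_zero] at hq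
  have h1 := hM (diagonal a *ᵥ v)
  have h2 : 0 ≤ κ * ‖diagonal a *ᵥ v‖ ^ 2 := by positivity
  have h3 : ∀ j ∈ Finset.univ, 0 ≤ pen j * v j ^ 2 := fun j _ => mul_nonneg (hpen j) (sq_nonneg _)
  have h4 := Finset.sum_nonneg h3
  have h5 : ‖diagonal a *ᵥ v‖ = 0 := by
    have : κ * ‖diagonal a *ᵥ v‖ ^ 2 = 0 := by linarith
    simpa [hκ.ne'] using this
  have h6 := (Finset.sum_eq_zero_iff_of_nonneg h3).1 (by linarith)
  refine hv (funext fun j => ?_)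
  rcases h j with hj | hj
  · have := congrFun (norm_eq_zero.1 h5) j
    simpa [mulVec_diagonal, hj] using this
  · simpa [hj.ne'] using h6 j (Finset.mem_univ j)

/-- The equation keeps its factor `a j`, so it stays meaningful at vanishing entries; `pen j * u j`
stands for the penalty gradient `pen j * b j / a j ^ 2` multiplied by `a j`. -/
theorem adaptiveRidge_normal_equation (X : Matrix (Fin n) m ℝ) (w : Fin n → ℝ) (pen a : m → ℝ)
    (y : Fin n → ℝ)
    (h : IsUnit (diagonal a * (Xᵀ * diagonal w * X) * diagonal a + diagonal pen).det) :
    ∃ u : m → ℝ, (∀ j, adaptiveRidge X w pen a y j = a j * u j) ∧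
      ∀ j, a j * ((Xᵀ * diagonal w * X) *ᵥ adaptiveRidge X w pen a y) j + pen j * u j =
        a j * (Xᵀ *ᵥ (diagonal w *ᵥ y)) j := by
  set M := Xᵀ * diagonal w * X
  set s := Xᵀ *ᵥ (diagonal w *ᵥ y) with hs
  set u := (diagonal a * M * diagonal a + diagonal pen)⁻¹ *ᵥ (diagonal a *ᵥ s) with hu
  have hb : adaptiveRidge X w pen a y = diagonal a *ᵥ u := rfl
  have hn : (diagonal a * M * diagonal a + diagonal pen) *ᵥ u = diagonal a *ᵥ s := by
    rw [hu, mulVec_mulVec, Matrix.mul_nonsing_inv _ h, one_mulVec]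
  refine ⟨u, fun j => by rw [hb, mulVec_diagonal], fun j => ?_⟩
  have := congrFun hn j
  rw [add_mulVec, Pi.add_apply, Matrix.mul_assoc, ← mulVec_mulVec, ← mulVec_mulVec, mulVec_diagonal,
    mulVec_diagonal, mulVec_diagonal, ← hb] at this
  exact this

/-- Solutions of the normal equations of adaptive ridge, in terms of the estimation error. -/
theorem adaptiveRidge_error_equation (X : Matrix (Fin n) m ℝ) (w : Fin n → ℝ) (pen a θ : m → ℝ)
    (e : Fin n → ℝ) {y : Fin n → ℝ} (hy : ∀ i, y i = (X *ᵥ θ) i + e i)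
    (h : IsUnit (diagonal a * (Xᵀ * diagonal w * X) * diagonal a + diagonal pen).det) :
    ∃ u : m → ℝ, (∀ j, adaptiveRidge X w pen a y j = a j * u j) ∧
      ∀ j, a j * ((Xᵀ * diagonal w * X) *ᵥ (adaptiveRidge X w pen a y - θ)) j + pen j * u j =
        a j * (Xᵀ *ᵥ (diagonal w *ᵥ e)) j := by
  obtain ⟨u, hu, hn⟩ := adaptiveRidge_normal_equation X w pen a y h
  refine ⟨u, hu, fun j => ?_⟩
  have hy' : y = X *ᵥ θ + e := funext hy
  have h1 : Xᵀ *ᵥ (diagonal w *ᵥ y) = (Xᵀ * diagonal w * X) *ᵥ θ + Xᵀ *ᵥ (diagonal w *ᵥ e) := by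
    rw [gramForm_mulVec, hy', mulVec_add, mulVec_add]
  have := hn j
  rw [h1, Pi.add_apply] at this
  rw [mulVec_sub, Pi.sub_apply]
  linarith

omit [DecidableEq m] in
-- Pairing the normal equations with `b - θ` turns coercivity into an error bound. The current
-- estimate has to be bounded below only where `θ` is nonzero.
theorem norm_error_le_of_normal_equation {a u b θ g r pen : m → ℝ} {κ L c : ℝ}
    (hc : 0 < c) (hL : 0 ≤ L)
    (hb : ∀ j, b j = a j * u j) (hn : ∀ j, a j * g j + pen j * u j = a j * r j)
    (hq : κ * ‖b - θ‖ ^ 2 ≤ (b - θ) ⬝ᵥ g) (hpen : ∀ j, 0 ≤ pen j) (hpenL : ∀ j, pen j ≤ L)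
    (ha : ∀ j, θ j ≠ 0 → c ≤ |a j|) :
    κ * ‖b - θ‖ ≤ Fintype.card m * (‖r‖ + L * ‖θ‖ / c ^ 2) := by
  have hR : 0 ≤ ‖r‖ + L * ‖θ‖ / c ^ 2 := by positivity
  have key : ∀ j, (b - θ) j * g j ≤ ‖b - θ‖ * (‖r‖ + L * ‖θ‖ / c ^ 2) := by
    intro j
    have hr : (b - θ) j * r j ≤ ‖b - θ‖ * ‖r‖ := by
      refine (le_abs_self _).trans ?_
      rw [abs_mul]
      exact mul_le_mul (norm_le_pi_norm (b - θ) j) (norm_le_pi_norm r j) (abs_nonneg _)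
        (norm_nonneg _)
    have hdiff : (b - θ) j * (g j - r j) ≤ ‖b - θ‖ * (L * ‖θ‖ / c ^ 2) := by
      -- At a zero of `θ` the penalty contributes `-(pen j * u j ^ 2)`, which can be dropped however
      -- small `a j` is. Elsewhere, splitting `b j = (b - θ) j + θ j` leaves a nonpositive square
      -- and a cross term of size `L * ‖θ‖ / c ^ 2`.
      by_cases hθ : θ j = 0
      · have : (b - θ) j * (g j - r j) = -(pen j * u j ^ 2) := by
          rw [Pi.sub_apply, hθ, sub_zero, hb j]
          linear_combination u j * hn j
        rw [this]
        have h1 := mul_nonneg (hpen j) (sq_nonneg (u j))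
        have h2 : 0 ≤ ‖b - θ‖ * (L * ‖θ‖ / c ^ 2) := by positivity
        linarith
      · have hca := ha j hθ
        have ha0 : a j ≠ 0 := abs_pos.1 (hc.trans_le hca)
        have hca2 : c ^ 2 ≤ a j ^ 2 := by
          rw [← sq_abs (a j)]; gcongr
        have h1 : g j - r j = -(pen j * b j / a j ^ 2) := by
          rw [hb j]
          field_simp
          linear_combination hn j
        have h2 : (b - θ) j * (g j - r j) =
            -(pen j * (b - θ) j ^ 2 / a j ^ 2) - (b - θ) j * θ j * (pen j / a j ^ 2) := by
          rw [h1, Pi.sub_apply]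
          ring
        have h3 : 0 ≤ pen j * (b - θ) j ^ 2 / a j ^ 2 :=
          div_nonneg (mul_nonneg (hpen j) (sq_nonneg _)) (sq_nonneg _)
        have h4 : -((b - θ) j * θ j) ≤ ‖b - θ‖ * ‖θ‖ := by
          refine (neg_le_abs _).trans ?_
          rw [abs_mul]
          exact mul_le_mul (norm_le_pi_norm (b - θ) j) (norm_le_pi_norm θ j) (abs_nonneg _)
            (norm_nonneg _)
        have h5 : pen j / a j ^ 2 ≤ L / c ^ 2 :=
          div_le_div₀ hL (hpenL j) (by positivity) hca2
        have h6 : 0 ≤ pen j / a j ^ 2 := div_nonneg (hpen j) (sq_nonneg _)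
        calc (b - θ) j * (g j - r j) ≤ -((b - θ) j * θ j) * (pen j / a j ^ 2) := by
              rw [h2]; linarith
          _ ≤ (‖b - θ‖ * ‖θ‖) * (pen j / a j ^ 2) := by gcongr
          _ ≤ (‖b - θ‖ * ‖θ‖) * (L / c ^ 2) := by gcongr
          _ = _ := by ring
    linarith [mul_sub ((b - θ) j) (g j) (r j)]
  have hsum : κ * ‖b - θ‖ ^ 2 ≤ Fintype.card m * (‖b - θ‖ * (‖r‖ + L * ‖θ‖ / c ^ 2)) := by
    refine hq.trans ((Finset.sum_le_sum fun j _ => key j).trans_eq ?_)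
    simp
  rcases (norm_nonneg (b - θ)).eq_or_lt with h0 | h0
  · rw [← h0, mul_zero]
    positivity
  · refine le_of_mul_le_mul_right ?_ h0
    linarith

/-- Adaptive ridge estimates are bounded by the score, whatever the penalty. -/
theorem norm_adaptiveRidge_le (X : Matrix (Fin n) m ℝ) (w : Fin n → ℝ) {pen : m → ℝ} (a : m → ℝ)
    (y : Fin n → ℝ) {κ : ℝ} (hpen : ∀ j, 0 ≤ pen j)
    (hM : ∀ v : m → ℝ, κ * ‖v‖ ^ 2 ≤ v ⬝ᵥ ((Xᵀ * diagonal w * X) *ᵥ v)) :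
    κ * ‖adaptiveRidge X w pen a y‖ ≤ Fintype.card m * ‖Xᵀ *ᵥ (diagonal w *ᵥ y)‖ := by
  by_cases h : IsUnit (diagonal a * (Xᵀ * diagonal w * X) * diagonal a + diagonal pen).det
  · obtain ⟨u, hu, hn⟩ := adaptiveRidge_error_equation X w pen a 0 y (y := y) (by simp) h
    -- With `θ = 0` no lower bound on `a` is required and the term carrying `L` vanishes, so any
    -- upper bound of the penalties serves as `L`.
    have := norm_error_le_of_normal_equation (c := 1) (L := ∑ j, pen j) one_pos
      (Finset.sum_nonneg fun j _ => hpen j) hu hn (hM _) hpen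
      (fun j => Finset.single_le_sum (fun i _ => hpen i) (Finset.mem_univ j)) (by simp)
    simpa using this
  -- The inverse of a singular matrix is `0` by convention, hence so is the estimate.
  · have : adaptiveRidge X w pen a y = 0 := by
      rw [adaptiveRidge, nonsing_inv_apply_not_isUnit _ h]
      simp
    rw [this, norm_zero, mul_zero]
    positivity

theorem norm_adaptiveRidge_sub_le (X : Matrix (Fin n) m ℝ) (w : Fin n → ℝ) {pen a θ : m → ℝ}
    {e y : Fin n → ℝ} {κ L c : ℝ} (hκ : 0 < κ) (hc : 0 < c) (hL : 0 ≤ L)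
    (hy : ∀ i, y i = (X *ᵥ θ) i + e i) (hpen : ∀ j, 0 ≤ pen j) (hpenL : ∀ j, pen j ≤ L)
    (hpa : ∀ j, a j ≠ 0 ∨ 0 < pen j) (ha : ∀ j, θ j ≠ 0 → c ≤ |a j|)
    (hM : ∀ v : m → ℝ, κ * ‖v‖ ^ 2 ≤ v ⬝ᵥ ((Xᵀ * diagonal w * X) *ᵥ v)) :
    κ * ‖adaptiveRidge X w pen a y - θ‖ ≤
      Fintype.card m * (‖Xᵀ *ᵥ (diagonal w *ᵥ e)‖ + L * ‖θ‖ / c ^ 2) := by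
  obtain ⟨u, hu, hn⟩ := adaptiveRidge_error_equation X w pen a θ e hy
    (isUnit_det_of_coercive hκ hM hpen hpa)
  exact norm_error_le_of_normal_equation hc hL hu hn (hM _) hpen hpenL ha

omit [DecidableEq m] in
theorem zeroNorm_le_mul {θ a b : m → ℝ} {c : ℝ} (hc : 0 ≤ c)
    (h : ∀ j, θ j = 0 → |b j| ≤ c * |a j|) : zeroNorm θ b ≤ c * zeroNorm θ a := by
  unfold zeroNorm
  rw [← Real.sqrt_sq hc, ← Real.sqrt_mul (sq_nonneg c), Finset.mul_sum]
  refine Real.sqrt_le_sqrt (Finset.sum_le_sum fun j hj => ?_)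
  have := h j (by simpa using hj)
  rw [← sq_abs (b j), ← sq_abs (a j), ← mul_pow]
  gcongr

/-- An adaptive ridge step shrinks the components at the zeros of the true parameter. -/
theorem zeroNorm_adaptiveRidge_le (X : Matrix (Fin n) m ℝ) (w : Fin n → ℝ) {pen a θ : m → ℝ}
    {e y : Fin n → ℝ} {κ K l R : ℝ} (hκ : 0 < κ) (hl : 0 < l) (hK : 0 ≤ K)
    (hy : ∀ i, y i = (X *ᵥ θ) i + e i) (hpenl : ∀ j, l ≤ pen j)
    (hR : ‖Xᵀ *ᵥ (diagonal w *ᵥ e)‖ + K * ‖adaptiveRidge X w pen a y - θ‖ ≤ R)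
    (hM : ∀ v : m → ℝ, κ * ‖v‖ ^ 2 ≤ v ⬝ᵥ ((Xᵀ * diagonal w * X) *ᵥ v))
    (hMK : ∀ v : m → ℝ, ‖(Xᵀ * diagonal w * X) *ᵥ v‖ ≤ K * ‖v‖) :
    zeroNorm θ (adaptiveRidge X w pen a y) ≤ ‖a - θ‖ * R / l * zeroNorm θ a := by
  obtain ⟨u, hu, hn⟩ := adaptiveRidge_error_equation X w pen a θ e hy
    (isUnit_det_of_coercive hκ hM (fun j => hl.le.trans (hpenl j))
      fun j => Or.inr (hl.trans_le (hpenl j)))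
  set b := adaptiveRidge X w pen a y
  set g := (Xᵀ * diagonal w * X) *ᵥ (b - θ) with hg
  set r := Xᵀ *ᵥ (diagonal w *ᵥ e)
  have hR0 : 0 ≤ R := le_trans (by positivity) hR
  refine zeroNorm_le_mul (by positivity) fun j hj => ?_
  have hp : 0 < pen j := hl.trans_le (hpenl j)
  -- Together with `b j = a j * u j` this is quadratic in `a j`; one factor is bounded by the error
  -- `‖a - θ‖` because `θ j = 0`.
  have hu' : u j = a j * (r j - g j) / pen j := by
    field_simp
    linear_combination hn j
  have haj : |a j| ≤ ‖a - θ‖ := by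
    have := norm_le_pi_norm (a - θ) j
    rwa [Pi.sub_apply, hj, sub_zero, Real.norm_eq_abs] at this
  have hrg : |r j - g j| ≤ R := by
    have h1 := norm_le_pi_norm r j
    have h2 := (norm_le_pi_norm g j).trans (hMK (b - θ))
    rw [Real.norm_eq_abs] at h1 h2
    exact (abs_sub _ _).trans ((add_le_add h1 h2).trans hR)
  rw [hu j, hu', abs_mul, abs_div, abs_mul, abs_of_pos hp, mul_comm]
  gcongr
  exact hpenl j

end LinearAlgebra

/-! ### Boundedness in probability -/

section BoundedInProb

variable {Ω : Type*} [MeasurableSpace Ω] {P : Measure Ω}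

/-- The sequence `f` is bounded above in probability: `max (f n) 0 = O_P(1)`. -/
def BoundedInProb (P : Measure Ω) (f : ℕ → Ω → ℝ) : Prop :=
  ∀ η : ENNReal, 0 < η → ∃ C : ℝ, 0 ≤ C ∧ ∀ᶠ n in atTop, P {ω | C < f n ω} ≤ η

theorem BoundedInProb.sup {f g : ℕ → Ω → ℝ} (hf : BoundedInProb P f) (hg : BoundedInProb P g) :
    BoundedInProb P (fun n ω => f n ω ⊔ g n ω) := by
  intro η hη
  obtain ⟨C, hC0, hC⟩ := hf (η / 2) (ENNReal.half_pos hη.ne')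
  obtain ⟨D, -, hD⟩ := hg (η / 2) (ENNReal.half_pos hη.ne')
  refine ⟨C ⊔ D, hC0.trans le_sup_left, ?_⟩
  filter_upwards [hC, hD] with n h1 h2
  calc P {ω | C ⊔ D < f n ω ⊔ g n ω} ≤ P ({ω | C < f n ω} ∪ {ω | D < g n ω}) := by
        refine measure_mono fun ω hω => ?_
        rcases lt_sup_iff.1 (show C ⊔ D < f n ω ⊔ g n ω from hω) with h | h
        · exact Or.inl (le_sup_left.trans_lt h)
        · exact Or.inr (le_sup_right.trans_lt h)
    _ ≤ η / 2 + η / 2 := (measure_union_le _ _).trans (add_le_add h1 h2)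
    _ = η := ENNReal.add_halves η

/-- On the event `f n ≤ C`, whose probability is close to `1`, a deterministic argument may be run
with constants depending on `C` only. -/
theorem BoundedInProb.of_imp {f g : ℕ → Ω → ℝ} (hf : BoundedInProb P f)
    (h : ∀ C : ℝ, 0 ≤ C → ∃ D : ℝ, 0 ≤ D ∧
      ∀ᶠ n in atTop, ∀ᵐ ω ∂P, f n ω ≤ C → g n ω ≤ D) : BoundedInProb P g := by
  intro η hη
  obtain ⟨C, hC0, hC⟩ := hf η hη
  obtain ⟨D, hD0, hD⟩ := h C hC0
  refine ⟨D, hD0, ?_⟩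
  filter_upwards [hC, hD] with n h1 h2
  refine le_trans (measure_mono_ae ?_) h1
  filter_upwards [h2] with ω hω hlt
  by_contra hcon
  exact (not_lt.2 (hω (not_lt.1 hcon))) hlt

theorem BoundedInProb.tendstoInMeasure {f g : ℕ → Ω → ℝ} (hf : BoundedInProb P f)
    (h : ∀ C : ℝ, 0 ≤ C → ∀ δ : ℝ, 0 < δ →
      ∀ᶠ n in atTop, ∀ᵐ ω ∂P, f n ω ≤ C → |g n ω| < δ) :
    TendstoInMeasure P g atTop (fun _ => (0 : ℝ)) := by
  rw [tendstoInMeasure_iff_norm]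
  intro δ hδ
  rw [ENNReal.tendsto_nhds_zero]
  intro η hη
  obtain ⟨C, hC0, hC⟩ := hf η hη
  filter_upwards [hC, h C hC0 δ hδ] with n h1 h2
  refine le_trans (measure_mono_ae ?_) h1
  filter_upwards [h2] with ω hω hle
  by_contra hcon
  have h3 : δ ≤ ‖g n ω - 0‖ := hle
  rw [sub_zero, Real.norm_eq_abs] at h3
  exact (not_lt.2 h3) (hω (not_lt.1 hcon))

theorem BoundedInProb.of_lintegral_le {f : ℕ → Ω → ℝ} {B : ENNReal} (hB : B ≠ ⊤)
    (hf : ∀ n, AEMeasurable (f n) P)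
    (h : ∀ᶠ n in atTop, ∫⁻ ω, ENNReal.ofReal (f n ω) ∂P ≤ B) : BoundedInProb P f := by
  intro η hη
  by_cases hη' : η = ⊤
  · exact ⟨0, le_rfl, by simp [hη']⟩
  have hdiv : B / η ≠ ⊤ := (ENNReal.div_lt_top hB hη.ne').ne
  -- Markov's inequality at level `B / η`; the added `1` keeps the level positive when `B = 0`.
  set C : ℝ := (B / η).toReal + 1 with hC
  have hC0 : 0 < C := by positivity
  have hBC : B / η ≤ ENNReal.ofReal C := by
    rw [← ENNReal.ofReal_toReal hdiv]
    exact ENNReal.ofReal_le_ofReal (by linarith)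
  refine ⟨C, hC0.le, ?_⟩
  filter_upwards [h] with n hn
  have hpos : ENNReal.ofReal C ≠ 0 := by simpa using hC0
  calc P {ω | C < f n ω} ≤ P {ω | ENNReal.ofReal C ≤ ENNReal.ofReal (f n ω)} :=
        measure_mono fun ω hω => ENNReal.ofReal_le_ofReal (le_of_lt hω)
    _ ≤ (∫⁻ ω, ENNReal.ofReal (f n ω) ∂P) / ENNReal.ofReal C :=
        meas_ge_le_lintegral_div (hf n).ennreal_ofReal hpos ENNReal.ofReal_ne_top
    _ ≤ B / ENNReal.ofReal C := by gcongr
    _ ≤ η := by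
        refine ENNReal.div_le_of_le_mul ?_
        rw [mul_comm]
        exact (ENNReal.div_le_iff_le_mul (Or.inl hη.ne') (Or.inl hη')).1 hBC

theorem BoundedInProb.of_integral_le {f : ℕ → Ω → ℝ} {B : ℝ}
    (hf : ∀ n, Integrable (f n) P) (h0 : ∀ n ω, 0 ≤ f n ω)
    (h : ∀ n, ∫ ω, f n ω ∂P ≤ B) : BoundedInProb P f := by
  refine BoundedInProb.of_lintegral_le (B := ENNReal.ofReal B) ENNReal.ofReal_ne_top
    (fun n => (hf n).aemeasurable) (Eventually.of_forall fun n => ?_)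
  rw [← ofReal_integral_eq_lintegral_ofReal (hf n) (Eventually.of_forall (h0 n))]
  exact ENNReal.ofReal_le_ofReal (h n)

/-- Averages of nonnegative variables with uniformly bounded means are bounded in probability. -/
theorem BoundedInProb.average {f : ℕ → ℕ → Ω → ℝ} {B : ENNReal} (hB : B ≠ ⊤)
    (hf : ∀ n i, Measurable (f n i)) (h0 : ∀ n i ω, 0 ≤ f n i ω)
    (h : ∀ᶠ n in atTop, ∀ i < n, ∫⁻ ω, ENNReal.ofReal (f n i ω) ∂P ≤ B) :
    BoundedInProb P (fun n ω => (n : ℝ)⁻¹ * ∑ i : Fin n, f n i ω) := by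
  refine BoundedInProb.of_lintegral_le hB
    (fun n => ((Finset.measurable_sum _ fun (i : Fin n) _ => hf n i).const_mul _).aemeasurable) ?_
  filter_upwards [h, eventually_ge_atTop 1] with n hn h1
  have hn0 : (0 : ℝ) < n := by exact_mod_cast h1
  have hn' : ENNReal.ofReal (n : ℝ)⁻¹ ≠ ⊤ := ENNReal.ofReal_ne_top
  calc ∫⁻ ω, ENNReal.ofReal ((n : ℝ)⁻¹ * ∑ i : Fin n, f n i ω) ∂P
      = ENNReal.ofReal (n : ℝ)⁻¹ * ∑ i : Fin n, ∫⁻ ω, ENNReal.ofReal (f n i ω) ∂P := by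
        rw [← lintegral_finsetSum _ fun (i : Fin n) _ => (hf n i).ennreal_ofReal,
          ← lintegral_const_mul' _ _ hn']
        refine lintegral_congr fun ω => ?_
        rw [ENNReal.ofReal_mul (by positivity),
          ENNReal.ofReal_sum_of_nonneg fun (i : Fin n) _ => h0 n i ω]
    _ ≤ ENNReal.ofReal (n : ℝ)⁻¹ * ∑ _i : Fin n, B := by
        gcongr with i
        exact hn i i.2
    _ = B := by
        rw [Finset.sum_const, Finset.card_univ, Fintype.card_fin, nsmul_eq_mul, ← mul_assoc,
          ENNReal.ofReal_inv_of_pos hn0, ENNReal.ofReal_natCast,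
          ENNReal.inv_mul_cancel (by exact_mod_cast hn0.ne') (ENNReal.natCast_ne_top n), one_mul]

end BoundedInProb

/-! ### The exponential kernel -/

section ExpKernel

variable {ι m : Type*} [Fintype ι] [Fintype m]

/-- The `k`-th power of the dot product is the inner product of `k`-fold tensor powers, indexed by
words `c : Fin k → m`, so the form is a sum of squares. -/
theorem sum_mul_dotProduct_pow_nonneg (z : ι → m → ℝ) (w : ι → ℝ) (k : ℕ) :
    0 ≤ ∑ i, ∑ l, w i * w l * (z i ⬝ᵥ z l) ^ k := by
  have h : ∑ i, ∑ l, w i * w l * (z i ⬝ᵥ z l) ^ k =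
      ∑ c : Fin k → m, (∑ i, w i * ∏ t, z i (c t)) ^ 2 := by
    calc ∑ i, ∑ l, w i * w l * (z i ⬝ᵥ z l) ^ k
        = ∑ i, ∑ l, ∑ c : Fin k → m, (w i * ∏ t, z i (c t)) * (w l * ∏ t, z l (c t)) := by
          refine Finset.sum_congr rfl fun i _ => Finset.sum_congr rfl fun l _ => ?_
          rw [dotProduct, Fintype.sum_pow, Finset.mul_sum]
          refine Finset.sum_congr rfl fun c _ => ?_
          rw [Finset.prod_mul_distrib]
          ring
      _ = ∑ i, ∑ c : Fin k → m, ∑ l, (w i * ∏ t, z i (c t)) * (w l * ∏ t, z l (c t)) :=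
          Finset.sum_congr rfl fun i _ => Finset.sum_comm
      _ = ∑ c : Fin k → m, ∑ i, ∑ l, (w i * ∏ t, z i (c t)) * (w l * ∏ t, z l (c t)) :=
          Finset.sum_comm
      _ = _ := Finset.sum_congr rfl fun c _ => by rw [sq, Finset.sum_mul_sum]
  rw [h]
  exact Finset.sum_nonneg fun _ _ => sq_nonneg _

/-- The kernel `exp (x ⬝ y)` is positive semidefinite. -/
theorem expKernel_nonneg (z : ι → m → ℝ) (w : ι → ℝ) :
    0 ≤ ∑ i, ∑ l, w i * w l * Real.exp (z i ⬝ᵥ z l) := by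
  -- The exponential series has nonnegative coefficients, so positivity passes from the powers to
  -- the kernel.
  have h : HasSum (fun k : ℕ => ∑ i, ∑ l, w i * w l * ((z i ⬝ᵥ z l) ^ k / (k.factorial : ℝ)))
      (∑ i, ∑ l, w i * w l * Real.exp (z i ⬝ᵥ z l)) := by
    refine hasSum_sum fun i _ => hasSum_sum fun l _ => HasSum.mul_left _ ?_
    rw [Real.exp_eq_exp_ℝ]
    exact NormedSpace.expSeries_div_hasSum_exp _
  refine h.nonneg fun k => ?_
  have h1 := sum_mul_dotProduct_pow_nonneg z w k
  have h2 : ∑ i, ∑ l, w i * w l * ((z i ⬝ᵥ z l) ^ k / (k.factorial : ℝ)) =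
      (∑ i, ∑ l, w i * w l * (z i ⬝ᵥ z l) ^ k) / k.factorial := by
    simp_rw [Finset.sum_div, mul_div_assoc]
  rw [h2]
  positivity

/-- Cauchy-Schwarz inequality for the exponential kernel, uniform in the exponent `β`. -/
theorem sq_sum_mul_exp_le (z : ι → m → ℝ) (w : ι → ℝ) (β : m → ℝ) :
    (∑ i, w i * Real.exp (z i ⬝ᵥ β)) ^ 2 ≤
      Real.exp (β ⬝ᵥ β) * ∑ i, ∑ l, w i * w l * Real.exp (z i ⬝ᵥ z l) := by
  have hq : ∀ t : ℝ, 0 ≤ Real.exp (β ⬝ᵥ β) * (t * t) +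
      (2 * ∑ i, w i * Real.exp (z i ⬝ᵥ β)) * t +
      ∑ i, ∑ l, w i * w l * Real.exp (z i ⬝ᵥ z l) := by
    intro t
    -- Adjoining `β` as an extra point with free weight `t` gives a quadratic polynomial in `t` that
    -- is nonnegative, and its discriminant is the claim.
    have h := expKernel_nonneg (fun o : Option ι => o.elim β z) (fun o : Option ι => o.elim t w)
    simp only [Fintype.sum_option, Option.elim] at h
    rw [Finset.sum_add_distrib] at h
    have h1 : ∑ l, t * w l * Real.exp (β ⬝ᵥ z l) = (∑ i, w i * Real.exp (z i ⬝ᵥ β)) * t := by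
      rw [Finset.sum_mul]
      refine Finset.sum_congr rfl fun i _ => ?_
      rw [dotProduct_comm]
      ring
    have h2 : ∑ l, w l * t * Real.exp (z l ⬝ᵥ β) = (∑ i, w i * Real.exp (z i ⬝ᵥ β)) * t := by
      rw [Finset.sum_mul]
      exact Finset.sum_congr rfl fun i _ => by ring
    rw [h1, h2] at h
    linarith
  have := discrim_le_zero hq
  rw [discrim] at this
  linarith

end ExpKernel

/-! ### Measurability of the estimators -/

section Measurability

variable {Ω : Type*} [MeasurableSpace Ω] {m : Type*} [Fintype m] [DecidableEq m] {n : ℕ}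

/-- By Cramer's formula, which also covers singular matrices since both inverses are then `0`. -/
theorem measurable_matrix_inv {A : Ω → Matrix m m ℝ} (hA : ∀ i j, Measurable fun ω => A ω i j)
    (i j : m) : Measurable fun ω => (A ω)⁻¹ i j := by
  have hA' : Measurable fun ω => (fun i j => A ω i j : m → m → ℝ) :=
    measurable_pi_lambda _ fun i => measurable_pi_lambda _ fun j => hA i j
  have hdet : Continuous fun B : m → m → ℝ => (Matrix.of B).det :=
    Continuous.matrix_det continuous_id
  have hadj : Continuous fun B : m → m → ℝ => (Matrix.of B).adjugate i j :=
    Continuous.matrix_elem (Continuous.matrix_adjugate continuous_id) i j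
  have h : (fun ω => (A ω)⁻¹ i j) = fun ω => (A ω).det⁻¹ * (A ω).adjugate i j := by
    funext ω
    rw [inv_def, Matrix.smul_apply, smul_eq_mul, Ring.inverse_eq_inv']
  rw [h]
  exact (hdet.measurable.comp hA').inv.mul (hadj.measurable.comp hA')

omit [DecidableEq m] in
theorem measurable_mulVec_apply {l : Type*} {A : Ω → Matrix l m ℝ} {v : Ω → m → ℝ}
    (hA : ∀ i j, Measurable fun ω => A ω i j) (hv : ∀ j, Measurable fun ω => v ω j) (i : l) :
    Measurable fun ω => (A ω *ᵥ v ω) i :=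
  Finset.measurable_sum _ fun j _ => (hA i j).mul (hv j)

theorem measurable_adaptiveRidge (X : Matrix (Fin n) m ℝ) {w y : Ω → Fin n → ℝ} (pen : m → ℝ)
    {a : Ω → m → ℝ} (hw : ∀ i, Measurable fun ω => w ω i) (ha : ∀ j, Measurable fun ω => a ω j)
    (hy : ∀ i, Measurable fun ω => y ω i) (j : m) :
    Measurable fun ω => adaptiveRidge X (w ω) pen (a ω) (y ω) j := by
  have hB : ∀ i j, Measurable fun ω =>
      (diagonal (a ω) * (Xᵀ * diagonal (w ω) * X) * diagonal (a ω) + diagonal pen) i j := by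
    intro i j
    simp only [Matrix.add_apply, diagonal_mul, mul_diagonal]
    simp only [mul_apply (N := X), mul_diagonal]
    refine Measurable.add ?_ measurable_const
    refine Measurable.mul (Measurable.mul (ha i) ?_) (ha j)
    exact Finset.measurable_sum _ fun k _ =>
      Measurable.mul (Measurable.mul measurable_const (hw k)) measurable_const
  have hs : ∀ j, Measurable fun ω =>
      (diagonal (a ω) *ᵥ (Xᵀ *ᵥ (diagonal (w ω) *ᵥ y ω))) j := by
    intro j
    simp only [mulVec_diagonal]
    refine (ha j).mul (measurable_mulVec_apply (A := fun _ => Xᵀ) (fun _ _ => measurable_const)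
      (fun i => ?_) j)
    simp only [mulVec_diagonal]
    exact (hw i).mul (hy i)
  have hu := measurable_mulVec_apply (measurable_matrix_inv hB) hs j
  have h : (fun ω => adaptiveRidge X (w ω) pen (a ω) (y ω) j) = fun ω => a ω j *
      ((diagonal (a ω) * (Xᵀ * diagonal (w ω) * X) * diagonal (a ω) + diagonal pen)⁻¹ *ᵥ
        (diagonal (a ω) *ᵥ (Xᵀ *ᵥ (diagonal (w ω) *ᵥ y ω)))) j :=
    funext fun ω => by rw [adaptiveRidge, mulVec_diagonal]
  rw [h]
  exact (ha j).mul hu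

/-- Measurability lets Markov's inequality be applied to inverse powers of the residuals. -/
theorem measurable_iterate {p q : ℕ} (X : ℕ → Fin p → ℝ) (Z : ℕ → Fin q → ℝ) (T : Tuning p q)
    {y : Ω → Fin n → ℝ} (hy : ∀ i, Measurable fun ω => y ω i) (k : ℕ) :
    (∀ j, Measurable fun ω => (iterate X Z T (y ω) k).1 j) ∧
      ∀ j, Measurable fun ω => (iterate X Z T (y ω) k).2 j := by
  have hlog : ∀ {a : Ω → Fin p → ℝ}, (∀ j, Measurable fun ω => a ω j) →
      ∀ i, Measurable fun ω => logRes X (y ω) (a ω) i := fun {a} ha i =>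
    Real.measurable_log.comp (((hy i).sub
      (Finset.measurable_sum _ fun j _ => measurable_const.mul (ha j))).pow_const 2)
  induction k with
  | zero =>
    have h1 : ∀ j, Measurable fun ω => (iterate X Z T (y ω) 0).1 j := fun j => by
      simp only [iterate, ridge_eq_adaptiveRidge]
      exact measurable_adaptiveRidge _ _ (fun _ => measurable_const) (fun _ => measurable_const)
        hy j
    refine ⟨h1, fun j => ?_⟩
    have h2 := hlog h1
    simp only [iterate, ridge_eq_adaptiveRidge] at h2 ⊢
    exact measurable_adaptiveRidge _ _ (fun _ => measurable_const) (fun _ => measurable_const) h2 j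
  | succ k ih =>
    have h1 : ∀ j, Measurable fun ω => (iterate X Z T (y ω) (k + 1)).1 j := fun j => by
      simp only [iterate]
      refine measurable_adaptiveRidge _ _ (fun i => ?_) ih.1 hy j
      refine Real.measurable_exp.comp (measurable_const.mul (measurable_const.mul ?_))
      exact Finset.measurable_sum _ fun j _ => measurable_const.mul (ih.2 _)
    refine ⟨h1, fun j => ?_⟩
    have h2 := hlog h1
    simp only [iterate] at h2 ⊢
    exact measurable_adaptiveRidge _ _ (fun _ => measurable_const) ih.2 h2 j

end Measurability

/-! ### Moments of the noise -/

section Moments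

variable {Ω : Type*} [MeasurableSpace Ω] {P : Measure Ω}

/-- Only an inequality: at `x = 0` and `t < 0` the real power is `0` and the extended one is `∞`. -/
theorem ofReal_rpow_le {x : ℝ} (hx : 0 ≤ x) (t : ℝ) :
    ENNReal.ofReal (x ^ t) ≤ ENNReal.ofReal x ^ t := by
  rcases hx.eq_or_lt with rfl | hx
  · rcases lt_trichotomy t 0 with h | h | h
    · simp [ENNReal.zero_rpow_of_neg h]
    · simp [h]
    · simp [Real.zero_rpow h.ne']
  · rw [ENNReal.ofReal_rpow_of_pos hx]

theorem lintegral_ofReal_rpow_le (f : Ω → ℝ) (t : ℝ) :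
    ∫⁻ ω, ENNReal.ofReal (|f ω| ^ t) ∂P ≤ absMoment P f t :=
  lintegral_mono fun _ => ofReal_rpow_le (abs_nonneg _) t

theorem absMoment_eq_of_identDistrib {f g : Ω → ℝ} (h : IdentDistrib f g P P) (t : ℝ) :
    absMoment P f t = absMoment P g t := by
  have hm : Measurable fun x : ℝ => (ENNReal.ofReal |x|) ^ t :=
    (ENNReal.measurable_ofReal.comp measurable_abs).pow_const t
  exact (h.comp hm).lintegral_eq

theorem ae_ne_zero_of_absMoment_lt_top {f : Ω → ℝ} (hf : Measurable f) {t : ℝ} (ht : t < 0)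
    (h : absMoment P f t < ⊤) : ∀ᵐ ω ∂P, f ω ≠ 0 := by
  have hm : Measurable fun ω => (ENNReal.ofReal |f ω|) ^ t :=
    (ENNReal.measurable_ofReal.comp hf.abs).pow_const t
  filter_upwards [ae_lt_top hm h.ne] with ω hω h0
  simp [h0, ENNReal.zero_rpow_of_neg ht] at hω

theorem integrable_abs_rpow {f : Ω → ℝ} (hf : Measurable f) {t : ℝ} (h : absMoment P f t < ⊤) :
    Integrable (fun ω => |f ω| ^ t) P := by
  refine ⟨(hf.abs.pow_const t).aestronglyMeasurable, ?_⟩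
  rw [hasFiniteIntegral_iff_ofReal (Eventually.of_forall fun ω => by positivity)]
  exact (lintegral_ofReal_rpow_le f t).trans_lt h

/-- Apply `log y ≤ y ^ κ / κ` to `|x|` and to its inverse. This trades logarithms for arbitrarily
small moments of either sign. -/
theorem abs_log_sq_le {κ : ℝ} (hκ : 0 < κ) (x : ℝ) :
    |Real.log (x ^ 2)| ≤ 2 / κ * (|x| ^ κ + |x| ^ (-κ)) := by
  have h0 : 0 ≤ |x| := abs_nonneg x
  have h1 := Real.log_le_rpow_div h0 hκ
  have h2 := Real.log_le_rpow_div (inv_nonneg.2 h0) hκ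
  rw [Real.log_inv, Real.inv_rpow h0, ← Real.rpow_neg h0] at h2
  have h3 : 0 ≤ |x| ^ κ / κ := by positivity
  have h4 : 0 ≤ |x| ^ (-κ) / κ := by positivity
  rw [Real.log_pow, ← Real.log_abs x, abs_mul]
  have h5 : |Real.log (|x|)| ≤ |x| ^ κ / κ + |x| ^ (-κ) / κ :=
    abs_le.2 ⟨by linarith, by linarith⟩
  calc |((2 : ℕ) : ℝ)| * |Real.log (|x|)| ≤ 2 * (|x| ^ κ / κ + |x| ^ (-κ) / κ) := by
        rw [Nat.cast_ofNat, abs_two]; gcongr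
    _ = _ := by ring

theorem NoiseRegular.absMoment_lt_top {ε : ℕ → Ω → ℝ} (h : NoiseRegular P ε) (i : ℕ) {t : ℝ}
    (ht : -1 < t) : absMoment P (ε i) t < ⊤ := by
  rw [absMoment_eq_of_identDistrib (h.ident i)]
  have := h.moments (-t) (by linarith)
  rwa [neg_neg] at this

theorem NoiseRegular.memLp_two {ε : ℕ → Ω → ℝ} (h : NoiseRegular P ε) (i : ℕ) :
    MemLp (ε i) 2 P := by
  rw [memLp_two_iff_integrable_sq (h.meas i).aestronglyMeasurable]
  have := integrable_abs_rpow (h.meas i) (h.absMoment_lt_top i (t := 2) (by norm_num))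
  simpa using this

theorem NoiseRegular.memLp_log [IsProbabilityMeasure P] {ε : ℕ → Ω → ℝ} (h : NoiseRegular P ε)
    (i : ℕ) : MemLp (fun ω => Real.log (ε i ω ^ 2)) 2 P := by
  have hm : Measurable fun ω => Real.log (ε i ω ^ 2) :=
    Real.measurable_log.comp ((h.meas i).pow_const 2)
  rw [memLp_two_iff_integrable_sq hm.aestronglyMeasurable]
  have h1 := integrable_abs_rpow (h.meas i) (h.absMoment_lt_top i (t := 1 / 2) (by norm_num))
  have h2 := integrable_abs_rpow (h.meas i) (h.absMoment_lt_top i (t := -(1 / 2)) (by norm_num))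
  refine ((h1.add h2).const_mul 128).mono' (hm.pow_const 2).aestronglyMeasurable
    (Eventually.of_forall fun ω => ?_)
  -- After squaring, the exponents are `±1/2`, within the range of available moments; `128 = 2 * 8 ^
  -- 2`.
  have h3 := abs_log_sq_le (κ := 1 / 4) (by norm_num) (ε i ω)
  have e1 : (|ε i ω| ^ (1 / 4 : ℝ)) ^ 2 = |ε i ω| ^ (1 / 2 : ℝ) := by
    rw [← Real.rpow_natCast, ← Real.rpow_mul (abs_nonneg _)]; norm_num
  have e2 : (|ε i ω| ^ (-(1 / 4) : ℝ)) ^ 2 = |ε i ω| ^ (-(1 / 2) : ℝ) := by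
    rw [← Real.rpow_natCast, ← Real.rpow_mul (abs_nonneg _)]; norm_num
  rw [Real.norm_eq_abs, abs_of_nonneg (sq_nonneg _), ← sq_abs]
  calc |Real.log (ε i ω ^ 2)| ^ 2
      ≤ (2 / (1 / 4) * (|ε i ω| ^ (1 / 4 : ℝ) + |ε i ω| ^ (-(1 / 4) : ℝ))) ^ 2 := by gcongr
    _ ≤ 128 * ((|ε i ω| ^ (1 / 4 : ℝ)) ^ 2 + (|ε i ω| ^ (-(1 / 4) : ℝ)) ^ 2) := by
        nlinarith [sq_nonneg (|ε i ω| ^ (1 / 4 : ℝ) - |ε i ω| ^ (-(1 / 4) : ℝ))]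
    _ = _ := by rw [e1, e2]; rfl

/-- Centred, pairwise independent variables with a common finite second moment. -/
structure WhiteNoise (P : Measure Ω) (ζ : ℕ → Ω → ℝ) (v : ℝ) : Prop where
  memLp : ∀ i, MemLp (ζ i) 2 P
  mean : ∀ i, ∫ ω, ζ i ω ∂P = 0
  second : ∀ i, ∫ ω, ζ i ω ^ 2 ∂P = v
  indep : ∀ i l, i ≠ l → IndepFun (ζ i) (ζ l) P

theorem NoiseRegular.whiteNoise [IsProbabilityMeasure P] {ε : ℕ → Ω → ℝ}
    (h : NoiseRegular P ε) : WhiteNoise P ε (∫ ω, ε 0 ω ^ 2 ∂P) where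
  memLp := h.memLp_two
  mean i := (h.ident i).integral_eq.trans h.mean
  second i := ((h.ident i).comp (measurable_id.pow_const 2)).integral_eq
  indep _ _ hil := h.indep.indepFun hil

theorem NoiseRegular.whiteNoise_log [IsProbabilityMeasure P] {ε : ℕ → Ω → ℝ}
    (h : NoiseRegular P ε) :
    WhiteNoise P (fun i ω => Real.log (ε i ω ^ 2) - logNoiseMean P ε)
      (∫ ω, (Real.log (ε 0 ω ^ 2) - logNoiseMean P ε) ^ 2 ∂P) := by
  have hm : Measurable fun x : ℝ => Real.log (x ^ 2) - logNoiseMean P ε :=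
    (Real.measurable_log.comp (measurable_id.pow_const 2)).sub_const _
  refine ⟨fun i => (h.memLp_log i).sub (memLp_const _), fun i => ?_, fun i => ?_,
    fun i l hil => ?_⟩
  · refine (((h.ident i).comp hm).integral_eq).trans ?_
    have hi : Integrable (fun ω => Real.log (ε 0 ω ^ 2)) P :=
      (h.memLp_log 0).integrable one_le_two
    simp only [Function.comp_apply]
    rw [integral_sub hi (integrable_const _)]
    simp [logNoiseMean]
  · exact ((h.ident i).comp (hm.pow_const 2)).integral_eq
  · exact (h.indep.indepFun hil).comp hm hm

theorem WhiteNoise.integrable_mul [IsProbabilityMeasure P] {ζ : ℕ → Ω → ℝ} {v : ℝ}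
    (h : WhiteNoise P ζ v) (i l : ℕ) : Integrable (fun ω => ζ i ω * ζ l ω) P :=
  (h.memLp i).integrable_mul (h.memLp l)

theorem WhiteNoise.integral_mul [IsProbabilityMeasure P] {ζ : ℕ → Ω → ℝ} {v : ℝ}
    (h : WhiteNoise P ζ v) (i l : ℕ) : ∫ ω, ζ i ω * ζ l ω ∂P = if i = l then v else 0 := by
  split_ifs with hil
  · subst hil
    rw [← h.second i]
    simp_rw [sq]
  · have := (h.indep i l hil).integral_mul_eq_mul_integral (h.memLp i).1 (h.memLp l).1
    simp only [Pi.mul_apply] at this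
    rw [this, h.mean i, zero_mul]

theorem WhiteNoise.integrable_quadForm [IsProbabilityMeasure P] {ζ : ℕ → Ω → ℝ} {v : ℝ}
    (h : WhiteNoise P ζ v) (A : ℕ → ℕ → ℝ) (n : ℕ) :
    Integrable (fun ω => ∑ i : Fin n, ∑ l : Fin n, A i l * (ζ i ω * ζ l ω)) P :=
  integrable_finsetSum _ fun i _ => integrable_finsetSum _ fun l _ =>
    (h.integrable_mul i l).const_mul _

theorem WhiteNoise.integral_quadForm [IsProbabilityMeasure P] {ζ : ℕ → Ω → ℝ} {v : ℝ}
    (h : WhiteNoise P ζ v) (A : ℕ → ℕ → ℝ) (n : ℕ) :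
    ∫ ω, ∑ i : Fin n, ∑ l : Fin n, A i l * (ζ i ω * ζ l ω) ∂P = ∑ i : Fin n, A i i * v := by
  have hi : ∀ i l : ℕ, Integrable (fun ω => A i l * (ζ i ω * ζ l ω)) P := fun i l =>
    (h.integrable_mul i l).const_mul _
  rw [integral_finsetSum (f := fun (i : Fin n) ω => ∑ l : Fin n, A i l * (ζ i ω * ζ l ω)) _
    fun i _ => integrable_finsetSum _ fun l _ => hi i l]
  refine Finset.sum_congr rfl fun i _ => ?_
  rw [integral_finsetSum (f := fun (l : Fin n) ω => A i l * (ζ i ω * ζ l ω)) _ fun l _ => hi i l]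
  simp_rw [integral_const_mul, h.integral_mul, Fin.val_inj]
  simp

/-- Weighted sums of white noise are `O_P(√n)`, locally uniformly over exponential tilts of the
weights. -/
theorem WhiteNoise.exists_score_bound [IsProbabilityMeasure P] {ζ : ℕ → Ω → ℝ} {v : ℝ}
    (h : WhiteNoise P ζ v) {m : Type*} [Fintype m] {q : ℕ} {c : ℕ → m → ℝ} {Z : ℕ → Fin q → ℝ}
    {C D : ℝ} (hc : ∀ i j, |c i j| ≤ C) (hZ : ∀ i, ‖Z i‖ ≤ D) :
    ∃ V : ℕ → Ω → ℝ, BoundedInProb P V ∧ ∀ n ω (β : Fin q → ℝ),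
      ‖fun j => ∑ i : Fin n, c i j * ζ i ω * Real.exp (Z i ⬝ᵥ β)‖ ≤
        √n * √(Real.exp (β ⬝ᵥ β) * V n ω) := by
  have hv : 0 ≤ v := by
    rw [← h.second 0]
    exact integral_nonneg fun ω => sq_nonneg _
  set A : ℕ → ℕ → ℝ := fun i l => (∑ j, c i j * c l j) * Real.exp (Z i ⬝ᵥ Z l) with hA
  -- `W j` is the kernel quadratic form that dominates the square of the `j`-th tilted sum, for all
  -- `β` at once.
  set W : m → ℕ → Ω → ℝ := fun j n ω => ∑ i : Fin n, ∑ l : Fin n,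
    (c i j * ζ i ω) * (c l j * ζ l ω) * Real.exp (Z i ⬝ᵥ Z l) with hW
  have hW0 : ∀ j n ω, 0 ≤ W j n ω := fun j n ω =>
    expKernel_nonneg (fun i : Fin n => Z i) (fun i : Fin n => c i j * ζ i ω)
  set V : ℕ → Ω → ℝ := fun n ω => (n : ℝ)⁻¹ * ∑ j, W j n ω with hV
  have hV' : ∀ n, V n = fun ω =>
      (n : ℝ)⁻¹ * ∑ i : Fin n, ∑ l : Fin n, A i l * (ζ i ω * ζ l ω) := by
    intro n
    funext ω
    simp only [hV, hW, hA]
    congr 1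
    rw [Finset.sum_comm]
    refine Finset.sum_congr rfl fun i _ => ?_
    rw [Finset.sum_comm]
    refine Finset.sum_congr rfl fun l _ => ?_
    rw [Finset.sum_mul, Finset.sum_mul]
    exact Finset.sum_congr rfl fun j _ => by ring
  have hC : 0 ≤ C ∨ IsEmpty m := by
    rcases isEmpty_or_nonempty m with hm | ⟨⟨j⟩⟩
    · exact Or.inr hm
    · exact Or.inl ((abs_nonneg _).trans (hc 0 j))
  have hAd : ∀ i, A i i ≤ Fintype.card m * C ^ 2 * Real.exp (q * (D * D)) := by
    intro i
    simp only [hA]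
    have h1 : ∑ j, c i j * c i j ≤ Fintype.card m * C ^ 2 := by
      calc ∑ j, c i j * c i j ≤ ∑ _j : m, C ^ 2 := Finset.sum_le_sum fun j _ => by
            rw [← sq, ← sq_abs]; exact pow_le_pow_left₀ (abs_nonneg _) (hc i j) 2
        _ = _ := by simp
    have h2 : Z i ⬝ᵥ Z i ≤ q * (D * D) := by
      refine (le_abs_self _).trans ((abs_dotProduct_le _ _).trans ?_)
      rw [Fintype.card_fin]
      have := hZ i
      gcongr
      exact (norm_nonneg _).trans this
    gcongr
  refine ⟨V, BoundedInProb.of_integral_le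
    (B := Fintype.card m * C ^ 2 * Real.exp (q * (D * D)) * v) (fun n => ?_) (fun n ω => ?_)
    (fun n => ?_), fun n ω β => ?_⟩
  · rw [hV']
    exact (h.integrable_quadForm A n).const_mul _
  · exact mul_nonneg (by positivity) (Finset.sum_nonneg fun j _ => hW0 j n ω)
  -- In expectation only the diagonal survives, leaving `n` bounded terms.
  · rw [hV', integral_const_mul, h.integral_quadForm]
    have hB : 0 ≤ Fintype.card m * C ^ 2 * Real.exp (q * (D * D)) * v := by positivity
    rcases Nat.eq_zero_or_pos n with rfl | hn
    · simpa using hB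
    · have hn' : (0 : ℝ) < n := by exact_mod_cast hn
      calc (n : ℝ)⁻¹ * ∑ i : Fin n, A i i * v
          ≤ (n : ℝ)⁻¹ * ∑ _i : Fin n, Fintype.card m * C ^ 2 * Real.exp (q * (D * D)) * v := by
            gcongr with i
            exact hAd i
        _ = _ := by
            rw [Finset.sum_const, Finset.card_univ, Fintype.card_fin, nsmul_eq_mul]
            field_simp
  · rw [← Real.sqrt_mul (Nat.cast_nonneg n)]
    refine (pi_norm_le_iff_of_nonneg (Real.sqrt_nonneg _)).2 fun j => ?_
    rw [Real.norm_eq_abs]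
    refine Real.abs_le_sqrt ?_
    have h1 := sq_sum_mul_exp_le (fun i : Fin n => Z i) (fun i : Fin n => c i j * ζ i ω) β
    have h2 : W j n ω ≤ ∑ j, W j n ω :=
      Finset.single_le_sum (fun j _ => hW0 j n ω) (Finset.mem_univ j)
    refine h1.trans ?_
    rcases Nat.eq_zero_or_pos n with rfl | hn
    · simp
    · have hn' : (0 : ℝ) < n := by exact_mod_cast hn
      have h3 : (n : ℝ) * (Real.exp (β ⬝ᵥ β) * V n ω) = Real.exp (β ⬝ᵥ β) * ∑ j, W j n ω := by
        simp only [hV]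
        field_simp
      rw [h3]
      exact mul_le_mul_of_nonneg_left h2 (Real.exp_nonneg _)

end Moments

/-! ### Perturbation of log squared residuals -/

theorem abs_log_one_sub_le {r : ℝ} (hr : |r| ≤ 1 / 2) : |Real.log (1 - r)| ≤ 2 * |r| := by
  obtain ⟨h1, h2⟩ := abs_le.1 hr
  have hpos : 0 < 1 - r := by linarith
  have hup := Real.log_le_sub_one_of_pos hpos
  have hlow := Real.one_sub_inv_le_log_of_pos hpos
  have h3 : 1 - (1 - r)⁻¹ = -(r / (1 - r)) := by field_simp; ring
  have h4 : r / (1 - r) ≤ 2 * |r| := by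
    rw [div_le_iff₀ hpos]
    rcases abs_cases r with ⟨h, h'⟩ | ⟨h, h'⟩ <;> rw [h] <;> nlinarith
  have h5 := neg_abs_le r
  have h6 := abs_nonneg r
  exact abs_le.2 ⟨by linarith, by linarith⟩

/-- The logarithm is Lipschitz near `1`, and a ratio at most `1/2` is below its `s`-th power.
Lowering the exponent to `s` means that only an inverse moment of order `s` of `x` will be needed.
-/
theorem abs_log_sq_sub_le {x t s : ℝ} (hx : x ≠ 0) (hs0 : 0 ≤ s) (hs1 : s ≤ 1)
    (ht : 2 * |t| ≤ |x|) :
    |Real.log ((x - t) ^ 2) - Real.log (x ^ 2)| ≤ 4 * (|t| / |x|) ^ s := by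
  have hx' : 0 < |x| := abs_pos.2 hx
  have hr : |t / x| ≤ 1 / 2 := by
    rw [abs_div, div_le_iff₀ hx']; linarith
  have hpos : 0 < 1 - t / x := by linarith [(abs_le.1 hr).2]
  have h1 : (x - t) ^ 2 = x ^ 2 * (1 - t / x) ^ 2 := by field_simp
  have h2 : Real.log ((x - t) ^ 2) - Real.log (x ^ 2) = 2 * Real.log (1 - t / x) := by
    rw [h1, Real.log_mul (pow_ne_zero _ hx) (pow_ne_zero _ hpos.ne'),
      Real.log_pow (n := 2) (1 - t / x)]
    push_cast
    ring
  have h3 : |t / x| ≤ |t / x| ^ s := by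
    conv_lhs => rw [← Real.rpow_one |t / x|]
    exact Real.rpow_le_rpow_of_exponent_ge' (abs_nonneg _) (by linarith) hs0 hs1
  rw [h2, abs_mul, abs_two, ← abs_div]
  linarith [abs_log_one_sub_le hr]

theorem rpow_neg_le_one_add {x s s' : ℝ} (hx : 0 < x) (hs0 : 0 ≤ s) (hs : s ≤ s') :
    x ^ (-s) ≤ 1 + x ^ (-s') := by
  have h0 : 0 ≤ x ^ (-s') := by positivity
  rcases le_total x 1 with h | h
  · have := Real.rpow_le_rpow_of_exponent_ge hx h (neg_le_neg hs)
    linarith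
  · have := Real.rpow_le_one_of_one_le_of_nonpos h (neg_nonpos.2 hs0)
    linarith

theorem rpow_le_one_add {x s : ℝ} (hx : 0 ≤ x) (hs0 : 0 ≤ s) (hs : s ≤ 1) : x ^ s ≤ 1 + x := by
  rcases le_total x 1 with h | h
  · have := Real.rpow_le_one hx h hs0
    linarith
  · have := Real.rpow_le_rpow_of_exponent_le h hs
    rw [Real.rpow_one] at this
    linarith

/-- Size of `log x ^ 2` when `x` is bounded and not smaller than a power of `N⁻¹`. -/
theorem abs_log_sq_le_of_rpow_le {x C U N a ξ : ℝ} (ha : 0 < a) (hξ : 0 < ξ) (hC : 0 ≤ C)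
    (hN : 1 ≤ N) (hx : |x| ≤ U) (hinv : |x| ^ (-a) ≤ C * N) :
    |Real.log (x ^ 2)| ≤ 2 / (a * ξ) * (U ^ (a * ξ) + C ^ ξ) * N ^ ξ := by
  have hU : 0 ≤ U := (abs_nonneg x).trans hx
  have hNξ : 1 ≤ N ^ ξ := Real.one_le_rpow hN hξ.le
  have h1 : |x| ^ (a * ξ) ≤ U ^ (a * ξ) * N ^ ξ := by
    calc |x| ^ (a * ξ) ≤ U ^ (a * ξ) := by gcongr
      _ ≤ _ := le_mul_of_one_le_right (by positivity) hNξ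
  have h2 : |x| ^ (-(a * ξ)) ≤ C ^ ξ * N ^ ξ := by
    rw [← Real.mul_rpow hC (by linarith), ← neg_mul, Real.rpow_mul (abs_nonneg _)]
    gcongr
  calc |Real.log (x ^ 2)| ≤ 2 / (a * ξ) * (|x| ^ (a * ξ) + |x| ^ (-(a * ξ))) :=
        abs_log_sq_le (by positivity) x
    _ ≤ 2 / (a * ξ) * (U ^ (a * ξ) * N ^ ξ + C ^ ξ * N ^ ξ) := by gcongr
    _ = _ := by ring

/-- Effect on a log squared residual of an estimation error of order `N ^ (-1/2)`. -/
theorem abs_log_residual_sub_le {s s' a τ C D : ℝ} (hs0 : 0 < s) (hs1 : s ≤ 1) (hss : s < s')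
    (ha : 0 < a) (hτ : 0 ≤ τ) (hC : 0 ≤ C) (hD : 0 ≤ D) :
    ∃ B : ℝ, 0 ≤ B ∧ ∀ N x z t : ℝ, 1 ≤ N → x ≠ 0 → |z| ≤ D → |t| ≤ τ * N ^ (-(1 / 2) : ℝ) →
      |Real.exp z * (x - t)| ^ (-a) ≤ C * N → |x| ^ (-a) ≤ C * N →
      |Real.log ((Real.exp z * (x - t)) ^ 2) - 2 * z - Real.log (x ^ 2)| ≤
        N ^ (-(s / 2)) * (B * (1 + |x| ^ (-s'))) := by
  -- Chosen so that `N ^ (-s'/2) * N ^ ξ = N ^ (-s/2)`: the surplus of inverse moments pays for a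
  -- logarithm of size `N ^ ξ`.
  set ξ := (s' - s) / 2 with hξ
  have hξ0 : 0 < ξ := by rw [hξ]; linarith
  set B₁ := 2 / (a * ξ) * ((Real.exp D * (3 * τ)) ^ (a * ξ) + C ^ ξ) with hB₁
  set B₂ := 2 / (a * ξ) * ((2 * τ) ^ (a * ξ) + C ^ ξ) with hB₂
  have hB₁0 : 0 ≤ B₁ := by positivity
  have hB₂0 : 0 ≤ B₂ := by positivity
  refine ⟨4 * τ ^ s + (2 * τ) ^ s' * (B₁ + 2 * D + B₂), by positivity, ?_⟩
  intro N x z t hN hx hz ht hη hxa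
  have hN0 : 0 < N := by linarith
  have hx' : 0 < |x| := abs_pos.2 hx
  have hxs : 0 ≤ |x| ^ (-s') := by positivity
  -- Either the perturbation is relatively small and the logarithm expands, or `x` is tiny, which is
  -- rare.
  by_cases hgood : 2 * |t| ≤ |x|
  · have hne : x - t ≠ 0 := by
      intro h
      have : x = t := by linarith
      rw [← this] at hgood
      linarith
    have h1 : Real.log ((Real.exp z * (x - t)) ^ 2) - 2 * z - Real.log (x ^ 2) =
        Real.log ((x - t) ^ 2) - Real.log (x ^ 2) := by
      rw [mul_pow, Real.log_mul (by positivity) (pow_ne_zero _ hne), Real.log_pow, Real.log_exp]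
      push_cast
      ring
    have h2 : (|t| / |x|) ^ s ≤ τ ^ s * N ^ (-(s / 2)) * (1 + |x| ^ (-s')) := by
      calc (|t| / |x|) ^ s ≤ (τ * N ^ (-(1 / 2) : ℝ) / |x|) ^ s := by gcongr
        _ = τ ^ s * N ^ (-(s / 2)) * |x| ^ (-s) := by
            rw [Real.div_rpow (by positivity) hx'.le, Real.mul_rpow hτ (by positivity),
              ← Real.rpow_mul hN0.le, Real.rpow_neg hx'.le, div_eq_mul_inv]
            congr 3
            ring
        _ ≤ _ := by
            gcongr
            exact rpow_neg_le_one_add hx' hs0.le hss.le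
    rw [h1]
    calc _ ≤ 4 * (|t| / |x|) ^ s := abs_log_sq_sub_le hx hs0.le hs1 hgood
      _ ≤ 4 * (τ ^ s * N ^ (-(s / 2)) * (1 + |x| ^ (-s'))) := by gcongr
      _ = N ^ (-(s / 2)) * (4 * τ ^ s * (1 + |x| ^ (-s'))) := by ring
      _ ≤ _ := by
          gcongr
          exact le_add_of_nonneg_right (by positivity)
  · have hbad : |x| < 2 * |t| := not_le.1 hgood
    have hNle : N ^ (-(1 / 2) : ℝ) ≤ 1 :=
      Real.rpow_le_one_of_one_le_of_nonpos hN (by norm_num)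
    have htτ : |t| ≤ τ := ht.trans (mul_le_of_le_one_right hτ hNle)
    have hU₁ : |Real.exp z * (x - t)| ≤ Real.exp D * (3 * τ) := by
      rw [abs_mul, Real.abs_exp]
      have h1 : |x - t| ≤ |x| + |t| := abs_sub _ _
      have h2 : z ≤ D := (le_abs_self z).trans hz
      gcongr
      linarith
    have hL₁ := abs_log_sq_le_of_rpow_le ha hξ0 hC hN hU₁ hη
    have hL₂ := abs_log_sq_le_of_rpow_le ha hξ0 hC hN (show |x| ≤ 2 * τ by linarith) hxa
    have hNξ : 1 ≤ N ^ ξ := Real.one_le_rpow hN hξ0.le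
    have hL : |Real.log ((Real.exp z * (x - t)) ^ 2) - 2 * z - Real.log (x ^ 2)| ≤
        (B₁ + 2 * D + B₂) * N ^ ξ := by
      have h1 := abs_sub (Real.log ((Real.exp z * (x - t)) ^ 2) - 2 * z) (Real.log (x ^ 2))
      have h2 := abs_sub (Real.log ((Real.exp z * (x - t)) ^ 2)) (2 * z)
      have h3 : |2 * z| ≤ 2 * D * N ^ ξ := by
        rw [abs_mul, abs_two]
        calc 2 * |z| ≤ 2 * D := by gcongr
          _ ≤ _ := le_mul_of_one_le_right (by positivity) hNξ
      calc _ ≤ B₁ * N ^ ξ + 2 * D * N ^ ξ + B₂ * N ^ ξ := by linarith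
        _ = _ := by ring
    -- Markov's inequality in pointwise form: the indicator of the bad case is at most `(2 * |t| /
    -- |x|) ^ s'`.
    have hcount : 1 ≤ (2 * τ) ^ s' * N ^ (-(s' / 2)) * |x| ^ (-s') := by
      have h1 : (1 : ℝ) ≤ (2 * τ * N ^ (-(1 / 2) : ℝ) / |x|) ^ s' := by
        refine Real.one_le_rpow ?_ (by linarith)
        rw [le_div_iff₀ hx']
        linarith
      refine h1.trans_eq ?_
      rw [Real.div_rpow (by positivity) hx'.le, Real.mul_rpow (by positivity) (by positivity),
        ← Real.rpow_mul hN0.le, Real.rpow_neg hx'.le, div_eq_mul_inv]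
      congr 3
      ring
    have hpow : N ^ (-(s' / 2)) * N ^ ξ = N ^ (-(s / 2)) := by
      rw [← Real.rpow_add hN0]
      congr 1
      rw [hξ]; ring
    calc _ ≤ (B₁ + 2 * D + B₂) * N ^ ξ := hL
      _ ≤ ((B₁ + 2 * D + B₂) * N ^ ξ) * ((2 * τ) ^ s' * N ^ (-(s' / 2)) * |x| ^ (-s')) :=
          le_mul_of_one_le_right (by positivity) hcount
      _ = (N ^ (-(s' / 2)) * N ^ ξ) * ((2 * τ) ^ s' * (B₁ + 2 * D + B₂) * |x| ^ (-s')) := by ring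
      _ = N ^ (-(s / 2)) * ((2 * τ) ^ s' * (B₁ + 2 * D + B₂) * |x| ^ (-s')) := by rw [hpow]
      _ ≤ _ := by
          gcongr
          · exact le_add_of_nonneg_left (by positivity)
          · linarith

theorem sum_abs_log_residual_sub_le {s s' a τ C D : ℝ} (hs0 : 0 < s) (hs1 : s ≤ 1) (hss : s < s')
    (ha : 0 < a) (hτ : 0 ≤ τ) (hC : 0 ≤ C) (hD : 0 ≤ D) :
    ∃ B : ℝ, 0 ≤ B ∧ ∀ n : ℕ, 1 ≤ n → ∀ x z t : Fin n → ℝ, (∀ i, x i ≠ 0) → (∀ i, |z i| ≤ D) →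
      (∀ i, |t i| ≤ τ * (n : ℝ) ^ (-(1 / 2) : ℝ)) →
      ∑ i, |Real.exp (z i) * (x i - t i)| ^ (-a) ≤ C * n → ∑ i, |x i| ^ (-a) ≤ C * n →
      ∑ i, |x i| ^ (-s') ≤ C * n →
      ∑ i, |Real.log ((Real.exp (z i) * (x i - t i)) ^ 2) - 2 * z i - Real.log (x i ^ 2)| ≤
        B * (n : ℝ) ^ (1 - s / 2) := by
  obtain ⟨B, hB0, hB⟩ := abs_log_residual_sub_le hs0 hs1 hss ha hτ hC hD
  refine ⟨B * (1 + C), by positivity, ?_⟩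
  intro n hn x z t hx hz ht hη hxa hxs
  have hn1 : (1 : ℝ) ≤ n := by exact_mod_cast hn
  have hn0 : (0 : ℝ) < n := by linarith
  -- A single nonnegative term is at most the sum, so each individual inverse power is at most `C *
  -- n`.
  have hsingle : ∀ f : Fin n → ℝ, (∀ i, 0 ≤ f i) → ∑ i, f i ≤ C * n → ∀ i, f i ≤ C * n :=
    fun f hf hsum i =>
      (Finset.single_le_sum (fun i _ => hf i) (Finset.mem_univ i)).trans hsum
  have hη' := hsingle _ (fun i => by positivity) hη
  have hxa' := hsingle _ (fun i => by positivity) hxa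
  calc _ ≤ ∑ i, (n : ℝ) ^ (-(s / 2)) * (B * (1 + |x i| ^ (-s'))) :=
        Finset.sum_le_sum fun i _ => hB n (x i) (z i) (t i) hn1 (hx i) (hz i) (ht i) (hη' i)
          (hxa' i)
    _ = (n : ℝ) ^ (-(s / 2)) * (B * (n + ∑ i, |x i| ^ (-s'))) := by
        rw [← Finset.mul_sum, ← Finset.mul_sum, Finset.sum_add_distrib]
        simp
    _ ≤ (n : ℝ) ^ (-(s / 2)) * (B * (n + C * n)) := by gcongr
    _ = B * (1 + C) * ((n : ℝ) ^ (1 : ℝ) * (n : ℝ) ^ (-(s / 2))) := by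
        rw [Real.rpow_one]; ring
    _ = _ := by
        rw [← Real.rpow_add hn0, sub_eq_add_neg]

theorem sum_abs_log_sq_le {n : ℕ} {a S₁ S₂ : ℝ} (ha : 0 < a) (ha1 : a ≤ 1) (x : Fin n → ℝ)
    (h1 : ∑ i, |x i| ≤ S₁) (h2 : ∑ i, |x i| ^ (-a) ≤ S₂) :
    ∑ i, |Real.log (x i ^ 2)| ≤ 2 / a * (n + S₁ + S₂) := by
  calc ∑ i, |Real.log (x i ^ 2)| ≤ ∑ i, 2 / a * ((1 + |x i|) + |x i| ^ (-a)) := by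
        refine Finset.sum_le_sum fun i _ => (abs_log_sq_le ha (x i)).trans ?_
        have := rpow_le_one_add (abs_nonneg (x i)) ha.le ha1
        gcongr
    _ = 2 / a * (n + ∑ i, |x i| + ∑ i, |x i| ^ (-a)) := by
        rw [← Finset.mul_sum, Finset.sum_add_distrib, Finset.sum_add_distrib]
        simp
    _ ≤ _ := by gcongr

/-! ### One step of adaptive ridge at a given rate -/

section Step

variable {m : Type*} [Fintype m] [DecidableEq m]

/-- Bounds on the weighted Gram matrix and on the score of a weighted regression with `n`
observations that give an estimation error of order `n ^ (-s/2)`. -/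
structure StepBounds {n : ℕ} (X : Matrix (Fin n) m ℝ) (w e : Fin n → ℝ) (s κ K : ℝ) : Prop where
  coercive : ∀ v : m → ℝ, κ * n * ‖v‖ ^ 2 ≤ v ⬝ᵥ ((Xᵀ * diagonal w * X) *ᵥ v)
  bounded : ∀ v : m → ℝ, ‖(Xᵀ * diagonal w * X) *ᵥ v‖ ≤ K * n * ‖v‖
  score : ‖Xᵀ *ᵥ (diagonal w *ᵥ e)‖ ≤ K * (n : ℝ) ^ (1 - s / 2)

/-- As `s ≤ 1`, penalties of order `√n` are dominated by the score order `n ^ (1 - s/2)`. -/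
theorem StepBounds.rate {n : ℕ} {X : Matrix (Fin n) m ℝ} {w e y : Fin n → ℝ} {s κ K c : ℝ}
    {pen a θ : m → ℝ} (h : StepBounds X w e s κ K) (hn : 1 ≤ n) (hs : s ≤ 1) (hκ : 0 < κ)
    (hc : 0 < c) (hy : ∀ i, y i = (X *ᵥ θ) i + e i)
    (hpen : ∀ j, 0 ≤ pen j) (hpenL : ∀ j, pen j ≤ √n) (hpa : ∀ j, a j ≠ 0 ∨ 0 < pen j)
    (ha : ∀ j, θ j ≠ 0 → c ≤ |a j|) :
    (n : ℝ) ^ (s / 2) * ‖adaptiveRidge X w pen a y - θ‖ ≤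
      Fintype.card m * (K + ‖θ‖ / c ^ 2) / κ := by
  have hn1 : (1 : ℝ) ≤ n := by exact_mod_cast hn
  have hn0 : (0 : ℝ) < n := by linarith
  have h1 := norm_adaptiveRidge_sub_le X w (mul_pos hκ hn0) hc (Real.sqrt_nonneg n) hy hpen hpenL
    hpa ha h.coercive
  have h2 : √(n : ℝ) ≤ (n : ℝ) ^ (1 - s / 2) := by
    rw [Real.sqrt_eq_rpow]
    exact Real.rpow_le_rpow_of_exponent_le hn1 (by linarith)
  have h3 : κ * n * ‖adaptiveRidge X w pen a y - θ‖ ≤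
      Fintype.card m * (K + ‖θ‖ / c ^ 2) * (n : ℝ) ^ (1 - s / 2) := by
    refine h1.trans ?_
    calc _ ≤ Fintype.card m * (K * (n : ℝ) ^ (1 - s / 2) +
          (n : ℝ) ^ (1 - s / 2) * ‖θ‖ / c ^ 2) := by
          gcongr
          exact h.score
      _ = _ := by ring
  have h4 : (n : ℝ) = (n : ℝ) ^ (1 - s / 2) * (n : ℝ) ^ (s / 2) := by
    rw [← Real.rpow_add hn0]
    simp
  have h5 : 0 < (n : ℝ) ^ (1 - s / 2) := by positivity
  rw [le_div_iff₀ hκ]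
  refine le_of_mul_le_mul_right ?_ h5
  calc _ = κ * ((n : ℝ) ^ (1 - s / 2) * (n : ℝ) ^ (s / 2)) *
        ‖adaptiveRidge X w pen a y - θ‖ := by ring
    _ ≤ _ := by rw [← h4]; exact h3

theorem StepBounds.zeroNorm_div_le {n : ℕ} {X : Matrix (Fin n) m ℝ} {w e y : Fin n → ℝ}
    {s κ K A B l : ℝ} {pen a θ : m → ℝ} (h : StepBounds X w e s κ K) (hn : 1 ≤ n)
    (hκ : 0 < κ) (hK : 0 ≤ K) (hl : 0 < l) (hy : ∀ i, y i = (X *ᵥ θ) i + e i)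
    (hpenl : ∀ j, l ≤ pen j) (hA : (n : ℝ) ^ (s / 2) * ‖a - θ‖ ≤ A)
    (hB : (n : ℝ) ^ (s / 2) * ‖adaptiveRidge X w pen a y - θ‖ ≤ B) :
    zeroNorm θ (adaptiveRidge X w pen a y) / zeroNorm θ a ≤
      A * (K + K * B) * ((n : ℝ) ^ (1 - s) / l) := by
  have hn1 : (1 : ℝ) ≤ n := by exact_mod_cast hn
  have hn0 : (0 : ℝ) < n := by linarith
  have hp : 0 < (n : ℝ) ^ (s / 2) := by positivity
  have hA0 : 0 ≤ A := le_trans (by positivity) hA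
  have hB0 : 0 ≤ B := le_trans (by positivity) hB
  have h4 : (n : ℝ) = (n : ℝ) ^ (1 - s / 2) * (n : ℝ) ^ (s / 2) := by
    rw [← Real.rpow_add hn0]
    simp
  have hR : ‖Xᵀ *ᵥ (diagonal w *ᵥ e)‖ + K * n * ‖adaptiveRidge X w pen a y - θ‖ ≤
      (K + K * B) * (n : ℝ) ^ (1 - s / 2) := by
    have h5 : K * n * ‖adaptiveRidge X w pen a y - θ‖ ≤ K * B * (n : ℝ) ^ (1 - s / 2) := by
      calc _ = K * ((n : ℝ) ^ (1 - s / 2) * (n : ℝ) ^ (s / 2)) *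
            ‖adaptiveRidge X w pen a y - θ‖ := by rw [← h4]
        _ = K * ((n : ℝ) ^ (s / 2) * ‖adaptiveRidge X w pen a y - θ‖) *
            (n : ℝ) ^ (1 - s / 2) := by ring
        _ ≤ _ := by gcongr
    linarith [h.score]
  have h1 := zeroNorm_adaptiveRidge_le X w (mul_pos hκ hn0) hl (by positivity) hy hpenl hR
    h.coercive h.bounded
  -- This form of the division bound includes a zero denominator, where the quotient is `0`.
  refine div_le_of_le_mul₀ (Real.sqrt_nonneg _) (by positivity) (h1.trans ?_)
  have hz : 0 ≤ zeroNorm θ a := Real.sqrt_nonneg _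
  have h6 : ‖a - θ‖ ≤ A * (n : ℝ) ^ (-(s / 2)) := by
    rw [Real.rpow_neg hn0.le, ← div_eq_mul_inv, le_div_iff₀ hp]
    linarith
  have h7 : (n : ℝ) ^ (-(s / 2)) * (n : ℝ) ^ (1 - s / 2) = (n : ℝ) ^ (1 - s) := by
    rw [← Real.rpow_add hn0]
    congr 1
    ring
  refine mul_le_mul_of_nonneg_right ?_ hz
  calc _ ≤ (A * (n : ℝ) ^ (-(s / 2))) * ((K + K * B) * (n : ℝ) ^ (1 - s / 2)) / l := by gcongr
    _ = A * (K + K * B) * (((n : ℝ) ^ (-(s / 2)) * (n : ℝ) ^ (1 - s / 2)) / l) := by ring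
    _ = _ := by rw [h7]

theorem SqrtNegligible.eventually_le {d : ℕ → m → ℝ} (h : SqrtNegligible d) :
    ∀ᶠ n : ℕ in atTop, ∀ j, d n j ≤ √n := by
  rw [eventually_all]
  intro j
  have h1 : Tendsto (fun n : ℕ => (√(n : ℝ))⁻¹ * d n j) atTop (𝓝 0) := by
    have h2 := (tendsto_pi_nhds.1 (tendsto_pi_nhds.1 h j)) j
    simpa using h2
  filter_upwards [h1.eventually_le_const one_pos, eventually_ge_atTop 1] with n hn hn1
  have h3 : 0 < √(n : ℝ) := Real.sqrt_pos.2 (by exact_mod_cast hn1)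
  rwa [inv_mul_le_iff₀ h3, mul_one] at hn

omit [DecidableEq m] in
theorem exists_pos_le_abs_of_ne_zero (θ : m → ℝ) : ∃ c : ℝ, 0 < c ∧ ∀ j, θ j ≠ 0 → c ≤ |θ j| := by
  by_cases h : (Finset.univ.filter fun j => θ j ≠ 0).Nonempty
  · obtain ⟨j₀, hj₀, hmin⟩ := Finset.exists_min_image _ (fun j => |θ j|) h
    exact ⟨|θ j₀|, abs_pos.2 (by simpa using hj₀), fun j hj => hmin j (by simpa using hj)⟩
  · refine ⟨1, one_pos, fun j hj => ?_⟩
    exact absurd ⟨j, by simpa using hj⟩ h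

variable {Ω : Type*} [MeasurableSpace Ω] {P : Measure Ω}

/-- The rate of an initial estimate is inherited by an adaptive ridge step, which moreover shrinks
the components at the zeros of the true parameter. -/
theorem adaptiveRidge_step {X : ∀ n, Matrix (Fin n) m ℝ} {w e y : ∀ n, Ω → Fin n → ℝ}
    {pen : ℕ → m → ℝ} {a b : ℕ → Ω → m → ℝ} {θ : m → ℝ} {f : ℕ → Ω → ℝ} {s : ℝ}
    (hs0 : 0 < s) (hs1 : s ≤ 1) (hf : BoundedInProb P f)
    (hstep : ∀ C : ℝ, 0 ≤ C → ∃ κ : ℝ, 0 < κ ∧ ∃ K : ℝ, 0 ≤ K ∧ ∀ᶠ n in atTop, ∀ᵐ ω ∂P,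
      f n ω ≤ C → StepBounds (X n) (w n ω) (e n ω) s κ K)
    (hy : ∀ n ω i, y n ω i = (X n *ᵥ θ) i + e n ω i)
    (hb : ∀ n ω, b n ω = adaptiveRidge (X n) (w n ω) (pen n) (a n ω) (y n ω))
    (ha : BoundedInProb P fun n ω => (n : ℝ) ^ (s / 2) * ‖a n ω - θ‖)
    (hpos : ∀ᶠ n in atTop, ∀ j, 0 < pen n j) (hpen : SqrtNegligible pen) :
    BoundedInProb P (fun n ω => (n : ℝ) ^ (s / 2) * ‖b n ω - θ‖) ∧
      (Tendsto (fun n : ℕ => (⨅ j, pen n j) / (n : ℝ) ^ (1 - s)) atTop atTop →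
        TendstoInMeasure P (fun n ω => zeroNorm θ (b n ω) / zeroNorm θ (a n ω)) atTop
          fun _ => (0 : ℝ)) := by
  obtain ⟨c, hc, hcθ⟩ := exists_pos_le_abs_of_ne_zero θ
  have hrate : ∀ C : ℝ, 0 ≤ C → ∃ κ : ℝ, 0 < κ ∧ ∃ K : ℝ, 0 ≤ K ∧ ∀ᶠ n in atTop, ∀ᵐ ω ∂P,
      f n ω ⊔ (n : ℝ) ^ (s / 2) * ‖a n ω - θ‖ ≤ C →
      StepBounds (X n) (w n ω) (e n ω) s κ K ∧ (n : ℝ) ^ (s / 2) * ‖b n ω - θ‖ ≤ K := by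
    intro C hC
    obtain ⟨κ, hκ, K, hK, hev⟩ := hstep C hC
    set K' := Fintype.card m * (K + ‖θ‖ / (c / 2) ^ 2) / κ with hK'
    have hK'0 : 0 ≤ K' := by positivity
    refine ⟨κ, hκ, K + K', by positivity, ?_⟩
    have htend : Tendsto (fun n : ℕ => (n : ℝ) ^ (s / 2)) atTop atTop :=
      (tendsto_rpow_atTop (by positivity)).comp tendsto_natCast_atTop_atTop
    filter_upwards [hev, eventually_ge_atTop 1, hpos, hpen.eventually_le,
      htend.eventually_ge_atTop (C / (c / 2) + 1)] with n h1 hn hp0 hp1 hlarge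
    filter_upwards [h1] with ω h2 hfC
    obtain ⟨hfC, haC⟩ := sup_le_iff.1 hfC
    have hsb := h2 hfC
    -- For large `n` the rate puts `a` within `c / 2` of `θ`, so its entries at the nonzero `θ j`
    -- are at least `c / 2` in absolute value.
    have hac : ‖a n ω - θ‖ ≤ c / 2 := by
      by_contra hcon
      have hcon' : c / 2 < ‖a n ω - θ‖ := not_le.1 hcon
      have h3 : (C / (c / 2) + 1) * (c / 2) ≤ C :=
        le_trans (mul_le_mul hlarge hcon'.le (by positivity) (by positivity)) haC
      have h4 : (C / (c / 2) + 1) * (c / 2) = C + c / 2 := by field_simp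
      linarith
    have hal : ∀ j, θ j ≠ 0 → c / 2 ≤ |a n ω j| := by
      intro j hj
      have h3 := (norm_le_pi_norm (a n ω - θ) j).trans hac
      rw [Pi.sub_apply, Real.norm_eq_abs] at h3
      have h4 := abs_sub_abs_le_abs_sub (θ j) (a n ω j)
      rw [abs_sub_comm] at h4
      linarith [hcθ j hj]
    have hr := hsb.rate hn hs1 hκ (half_pos hc) (hy n ω) (fun j => (hp0 j).le) hp1
      (fun j => Or.inr (hp0 j)) hal
    rw [← hb] at hr
    refine ⟨⟨hsb.coercive, fun v => (hsb.bounded v).trans ?_, hsb.score.trans ?_⟩, ?_⟩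
    · gcongr
      linarith
    · gcongr
      linarith
    · linarith
  refine ⟨(hf.sup ha).of_imp fun C hC => ?_, fun hmin =>
    (hf.sup ha).tendstoInMeasure fun C hC δ hδ => ?_⟩
  · obtain ⟨κ, -, K, hK, hev⟩ := hrate C hC
    refine ⟨K, hK, ?_⟩
    filter_upwards [hev] with n h1
    filter_upwards [h1] with ω h2 hle
    exact (h2 hle).2
  · obtain ⟨κ, hκ, K, hK, hev⟩ := hrate C hC
    have hB : 0 ≤ C * (K + K * K) := by positivity
    filter_upwards [hev, eventually_ge_atTop 1, hmin.eventually_gt_atTop (C * (K + K * K) / δ)]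
      with n h1 hn hm
    filter_upwards [h1] with ω h2 hle
    obtain ⟨hsb, hbK⟩ := h2 hle
    have hn0 : (0 : ℝ) < n := by exact_mod_cast hn
    have hq : 0 < (⨅ j, pen n j) / (n : ℝ) ^ (1 - s) := lt_of_le_of_lt (by positivity) hm
    have hl : 0 < ⨅ j, pen n j := by
      have := mul_pos hq (show 0 < (n : ℝ) ^ (1 - s) by positivity)
      rwa [div_mul_cancel₀ _ (by positivity)] at this
    rw [hb] at hbK
    have h3 := hsb.zeroNorm_div_le hn hκ hK hl (hy n ω)
      (fun j => ciInf_le (Set.finite_range _).bddBelow j) (sup_le_iff.1 hle).2 hbK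
    rw [← hb] at h3
    have h4 : 0 ≤ zeroNorm θ (b n ω) / zeroNorm θ (a n ω) :=
      div_nonneg (Real.sqrt_nonneg _) (Real.sqrt_nonneg _)
    rw [abs_of_nonneg h4]
    refine h3.trans_lt ?_
    rw [div_lt_iff₀ hδ] at hm
    rw [← inv_div, ← div_eq_mul_inv, div_lt_iff₀ hq]
    linarith

end Step

/-! ### The estimators in the heteroscedastic model -/

/-- Uniform coercivity and boundedness of the designs. -/
structure DesignBounds {p q : ℕ} (X : ℕ → Fin p → ℝ) (Z : ℕ → Fin q → ℝ) (κ C : ℝ) : Prop where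
  pos : 0 < κ
  nonneg : 0 ≤ C
  coerciveX : ∀ᶠ n : ℕ in atTop, ∀ v : Fin p → ℝ,
    κ * n * ‖v‖ ^ 2 ≤ v ⬝ᵥ (((designMatrix X n)ᵀ * designMatrix X n) *ᵥ v)
  coerciveZStar : ∀ᶠ n : ℕ in atTop, ∀ v : Fin (q + 1) → ℝ,
    κ * n * ‖v‖ ^ 2 ≤ v ⬝ᵥ (((designMatrix (zStar Z) n)ᵀ * designMatrix (zStar Z) n) *ᵥ v)
  normX : ∀ i, ‖X i‖ ≤ C
  normZ : ∀ i, ‖Z i‖ ≤ C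
  normZStar : ∀ i, ‖zStar Z i‖ ≤ C

theorem eventually_coercive_of_tendsto_gram {p : ℕ} {X : ℕ → Fin p → ℝ}
    {S : Matrix (Fin p) (Fin p) ℝ} (hS : S.PosDef) (h : Tendsto (gram X) atTop (𝓝 S)) :
    ∃ κ : ℝ, 0 < κ ∧ ∀ᶠ n : ℕ in atTop, ∀ v : Fin p → ℝ,
      κ * n * ‖v‖ ^ 2 ≤ v ⬝ᵥ (((designMatrix X n)ᵀ * designMatrix X n) *ᵥ v) := by
  obtain ⟨κ, hκ, hev⟩ := eventually_coercive_of_tendsto hS h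
  refine ⟨κ, hκ, ?_⟩
  filter_upwards [hev, eventually_ge_atTop 1] with n h1 hn v
  have hn0 : (0 : ℝ) < n := by exact_mod_cast hn
  have h2 := h1 v
  rw [gram, smul_mulVec, dotProduct_smul, smul_eq_mul, ← div_eq_inv_mul, le_div_iff₀ hn0] at h2
  linarith

theorem DesignRegular.exists_designBounds {p q : ℕ} {X : ℕ → Fin p → ℝ} {Z : ℕ → Fin q → ℝ}
    {β₀ : Fin q → ℝ} {Θ : Set (Fin q → ℝ)} (h1 : DesignRegular X Z β₀ Θ)
    (h2 : BoundedDesign X Z) : ∃ κ C : ℝ, DesignBounds X Z κ C := by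
  obtain ⟨S₁, hS₁, hlim₁⟩ := h1.limX
  obtain ⟨S₂, hS₂, hlim₂⟩ := h1.limZStar
  obtain ⟨κ₁, hκ₁, hev₁⟩ := eventually_coercive_of_tendsto_gram hS₁ hlim₁
  obtain ⟨κ₂, hκ₂, hev₂⟩ := eventually_coercive_of_tendsto_gram hS₂ hlim₂
  obtain ⟨C₁, hC₁⟩ := isBounded_iff_forall_norm_le.1 h2.bddX
  obtain ⟨C₂, hC₂⟩ := isBounded_iff_forall_norm_le.1 h2.bddZStar
  have hX : ∀ i, ‖X i‖ ≤ C₁ := fun i => hC₁ _ ⟨i, rfl⟩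
  have hZ : ∀ i, ‖zStar Z i‖ ≤ C₂ := fun i => hC₂ _ ⟨i, rfl⟩
  refine ⟨min κ₁ κ₂, max C₁ C₂, lt_min hκ₁ hκ₂, ?_, ?_, ?_, ?_, ?_, ?_⟩
  · exact ((norm_nonneg _).trans (hX 0)).trans (le_max_left _ _)
  · filter_upwards [hev₁] with n hn v
    refine le_trans ?_ (hn v)
    gcongr
    exact min_le_left _ _
  · filter_upwards [hev₂] with n hn v
    refine le_trans ?_ (hn v)
    gcongr
    exact min_le_right _ _
  · exact fun i => (hX i).trans (le_max_left _ _)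
  · intro i
    refine le_trans ?_ ((hZ i).trans (le_max_right _ _))
    refine (pi_norm_le_iff_of_nonneg (norm_nonneg _)).2 fun j => ?_
    have := norm_le_pi_norm (zStar Z i) j.castSucc
    simpa [zStar, withOne] using this
  · exact fun i => (hZ i).trans (le_max_right _ _)

theorem norm_init_le {q : ℕ} (v : Fin (q + 1) → ℝ) : ‖(Fin.init v : Fin q → ℝ)‖ ≤ ‖v‖ :=
  (pi_norm_le_iff_of_nonneg (norm_nonneg _)).2 fun j => norm_le_pi_norm v j.castSucc

theorem abs_half_dotProduct_le {q : ℕ} {z β : Fin q → ℝ} {C D : ℝ} (hz : ‖z‖ ≤ C)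
    (hβ : ‖β‖ ≤ D) : |1 / 2 * (z ⬝ᵥ β)| ≤ q * (C * D) := by
  have h1 := abs_dotProduct_le z β
  rw [Fintype.card_fin] at h1
  have h2 : ‖z‖ * ‖β‖ ≤ C * D :=
    mul_le_mul hz hβ (norm_nonneg _) ((norm_nonneg _).trans hz)
  have h3 : (q : ℝ) * (‖z‖ * ‖β‖) ≤ q * (C * D) := by gcongr
  rw [abs_mul, abs_of_pos (by norm_num : (0 : ℝ) < 1 / 2)]
  linarith [abs_nonneg (z ⬝ᵥ β)]

section Model

variable {Ω : Type*} [MeasurableSpace Ω] {P : Measure Ω} [IsProbabilityMeasure P] {p q : ℕ}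
  {X : ℕ → Fin p → ℝ} {Z : ℕ → Fin q → ℝ} {α₀ : Fin p → ℝ} {β₀ : Fin q → ℝ} {ε : ℕ → Ω → ℝ}
  {T : Tuning p q} {κ C₀ : ℝ}

/-- The weighted regressions of the first stage satisfy the bounds of the parametric rate,
uniformly over bounded sets of scale parameters. -/
theorem exists_location_stepBounds (hD : DesignBounds X Z κ C₀)
    (hε : NoiseRegular P ε) (β₀ : Fin q → ℝ) :
    ∃ V : ℕ → Ω → ℝ, BoundedInProb P V ∧ ∀ C : ℝ, 0 ≤ C → ∃ κ' : ℝ, 0 < κ' ∧ ∃ K : ℝ, 0 ≤ K ∧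
      ∀ᶠ n : ℕ in atTop, ∀ ω (β : Fin q → ℝ), ‖β‖ ≤ C → V n ω ≤ C →
        StepBounds (designMatrix X n) (scalePow Z β (-2) n)
          (fun i => Real.exp (1 / 2 * (Z i ⬝ᵥ β₀)) * ε i ω) 1 κ' K := by
  have hC₀ := hD.nonneg
  set E := Real.exp (q * (C₀ * ‖β₀‖)) with hE
  have hX : ∀ i j, |X i j| ≤ C₀ := fun i j => (norm_le_pi_norm (X i) j).trans (hD.normX i)
  have hc : ∀ (i : ℕ) (j : Fin p), |X i j * Real.exp (1 / 2 * (Z i ⬝ᵥ β₀))| ≤ C₀ * E := by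
    intro i j
    rw [abs_mul, Real.abs_exp]
    have h1 : Real.exp (1 / 2 * (Z i ⬝ᵥ β₀)) ≤ E := Real.exp_le_exp.2
      ((le_abs_self _).trans (abs_half_dotProduct_le (hD.normZ i) le_rfl))
    have h2 := hX i j
    gcongr
  -- The true scale goes into the coefficients; the weight `exp (-Z_i ⬝ β)` is the tilt, used at
  -- `-β`.
  obtain ⟨V, hV, hbound⟩ := hε.whiteNoise.exists_score_bound hc hD.normZ
  refine ⟨V, hV, fun C hC => ?_⟩
  set D := (2 : ℝ) * (q * (C₀ * C)) with hDdef
  set K₁ := C₀ * Real.exp D * (p * C₀) with hK₁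
  set K₂ := √(Real.exp (q * (C * C)) * C) with hK₂
  refine ⟨Real.exp (-D) * κ, mul_pos (Real.exp_pos _) hD.pos, K₁ + K₂, by positivity, ?_⟩
  filter_upwards [hD.coerciveX] with n hn ω β hβ hVC
  have hexp : ∀ i : Fin n, |-2 * (1 / 2 * (Z i ⬝ᵥ β))| ≤ D := fun i => by
    rw [abs_mul, abs_neg, abs_two]
    exact mul_le_mul_of_nonneg_left (abs_half_dotProduct_le (hD.normZ i) hβ) two_pos.le
  have hlow : ∀ i, Real.exp (-D) ≤ scalePow Z β (-2) n i := fun i =>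
    Real.exp_le_exp.2 (abs_le.1 (hexp i)).1
  have hup : ∀ i, |scalePow Z β (-2) n i| ≤ Real.exp D := fun i => by
    rw [scalePow, Real.abs_exp]
    exact Real.exp_le_exp.2 (abs_le.1 (hexp i)).2
  refine ⟨fun v => ?_, fun v => ?_, ?_⟩
  · have := coercive_gramForm (designMatrix X n) (κ := κ * n) (Real.exp_nonneg (-D)) _ hlow hn v
    linarith
  · refine (norm_gramForm_mulVec_le (designMatrix X n) hC₀ (Real.exp_nonneg D)
      (fun i j => hX i j) _ hup v).trans ?_
    rw [Fintype.card_fin]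
    gcongr
    exact le_add_of_nonneg_right (Real.sqrt_nonneg _)
  · have h1 : (designMatrix X n)ᵀ *ᵥ (diagonal (scalePow Z β (-2) n) *ᵥ
        fun i : Fin n => Real.exp (1 / 2 * (Z i ⬝ᵥ β₀)) * ε i ω) = fun j => ∑ i : Fin n,
          X i j * Real.exp (1 / 2 * (Z i ⬝ᵥ β₀)) * ε i ω * Real.exp (Z i ⬝ᵥ (-β)) := by
      funext j
      rw [transpose_mul_diagonal_mulVec_apply]
      refine Finset.sum_congr rfl fun i _ => ?_
      have h2 : scalePow Z β (-2) n i = Real.exp (Z i ⬝ᵥ (-β)) := by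
        rw [scalePow, dotProduct_neg]
        congr 1
        ring
      rw [h2, designMatrix, of_apply]
      ring
    rw [h1]
    refine (hbound n ω (-β)).trans ?_
    have h3 : (n : ℝ) ^ (1 - (1 : ℝ) / 2) = √n := by
      rw [Real.sqrt_eq_rpow]
      norm_num
    have h4 : (-β) ⬝ᵥ (-β) ≤ q * (C * C) := by
      refine (le_abs_self _).trans ((abs_dotProduct_le _ _).trans ?_)
      rw [norm_neg, Fintype.card_fin]
      gcongr
    have h5 : √(Real.exp ((-β) ⬝ᵥ (-β)) * V n ω) ≤ K₂ := by
      refine Real.sqrt_le_sqrt ?_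
      calc _ ≤ Real.exp ((-β) ⬝ᵥ (-β)) * C := by gcongr
        _ ≤ _ := by gcongr
    rw [h3, mul_comm]
    gcongr
    have : 0 ≤ K₁ := by positivity
    linarith

/-- The residuals of the `k`-th location estimate. -/
noncomputable def residual (X : ℕ → Fin p → ℝ) (Z : ℕ → Fin q → ℝ) (α₀ : Fin p → ℝ)
    (β₀ : Fin q → ℝ) (ε : ℕ → Ω → ℝ) (T : Tuning p q) (k n i : ℕ) (ω : Ω) : ℝ :=
  Real.exp (1 / 2 * (Z i ⬝ᵥ β₀)) * ε i ω - X i ⬝ᵥ (alphaHat X Z α₀ β₀ ε T k n ω - α₀)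

omit [MeasurableSpace Ω] in
theorem logRes_alphaHat_apply (k n : ℕ) (ω : Ω) (i : Fin n) :
    logRes X (fun i : Fin n => response X Z α₀ β₀ ε i ω) (alphaHat X Z α₀ β₀ ε T k n ω) i =
      Real.log (residual X Z α₀ β₀ ε T k n i ω ^ 2) := by
  rw [logRes, residual, response, dotProduct_sub]
  congr 2
  ring

theorem measurable_residual (hε : ∀ i, Measurable (ε i)) (k n i : ℕ) :
    Measurable (residual X Z α₀ β₀ ε T k n i) := by
  have h1 := (measurable_iterate X Z T (n := n)
    (y := fun ω i => response X Z α₀ β₀ ε i ω)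
    (fun i => ((hε i).const_mul _).const_add _) k).1
  refine ((hε i).const_mul _).sub ?_
  exact Finset.measurable_sum _ fun j _ => ((h1 j).sub_const _).const_mul _

omit [IsProbabilityMeasure P] in
theorem exists_residual_inverse_moment (hε : ∀ i, Measurable (ε i))
    (hA4 : ResidualInverseMoments P X Z α₀ β₀ ε T) (k : ℕ) :
    ∃ a : ℝ, 0 < a ∧ a < 1 ∧ BoundedInProb P fun n ω =>
      (n : ℝ)⁻¹ * ∑ i : Fin n, |residual X Z α₀ β₀ ε T k n i ω| ^ (-a) := by
  obtain ⟨a, ha0, ha1, N, hN⟩ := hA4 k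
  refine ⟨a, ha0, ha1, BoundedInProb.average (f := fun n i ω =>
    |residual X Z α₀ β₀ ε T k n i ω| ^ (-a)) hN.ne
    (fun n i => (measurable_residual hε k n i).abs.pow_const _)
    (fun n i ω => by positivity) ?_⟩
  filter_upwards [eventually_gt_atTop N] with n hn i hi
  refine (lintegral_ofReal_rpow_le _ _).trans ?_
  exact le_iSup_of_le n (le_iSup_of_le hn (le_iSup_of_le ⟨i, hi⟩ le_rfl))

omit [IsProbabilityMeasure P] in
theorem NoiseRegular.average_rpow (hε : NoiseRegular P ε) {t : ℝ}
    (ht : absMoment P (ε 0) t < ⊤) :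
    BoundedInProb P fun n ω => (n : ℝ)⁻¹ * ∑ i : Fin n, |ε i ω| ^ t := by
  refine BoundedInProb.average (f := fun _ i ω => |ε i ω| ^ t) ht.ne
    (fun _ i => (hε.meas i).abs.pow_const _) (fun _ i ω => by positivity)
    (Eventually.of_forall fun n i _ => ?_)
  rw [← absMoment_eq_of_identDistrib (hε.ident i)]
  exact lintegral_ofReal_rpow_le _ _

theorem sum_le_of_average_le {n : ℕ} (hn : 1 ≤ n) {S C : ℝ} (h : (n : ℝ)⁻¹ * S ≤ C) :
    S ≤ C * n := by
  have hn0 : (0 : ℝ) < n := by exact_mod_cast hn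
  rwa [← div_eq_inv_mul, div_le_iff₀ hn0] at h

theorem le_mul_rpow_neg_of_rpow_mul_le {n : ℕ} (hn : 1 ≤ n) {t x C : ℝ}
    (h : (n : ℝ) ^ t * x ≤ C) : x ≤ C * (n : ℝ) ^ (-t) := by
  have hn0 : (0 : ℝ) < n := by exact_mod_cast hn
  rw [Real.rpow_neg hn0.le, ← div_eq_mul_inv, le_div_iff₀ (by positivity)]
  linarith

omit [IsProbabilityMeasure P] in
/-- The log squared residuals are bounded on average. -/
theorem logResiduals_average (hD : DesignBounds X Z κ C₀) (hε : NoiseRegular P ε)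
    (hA4 : ResidualInverseMoments P X Z α₀ β₀ ε T) (k : ℕ)
    (hα : BoundedInProb P fun n ω =>
      (n : ℝ) ^ ((1 : ℝ) / 2) * ‖alphaHat X Z α₀ β₀ ε T k n ω - α₀‖) :
    BoundedInProb P fun n ω =>
      (n : ℝ)⁻¹ * ∑ i : Fin n, |Real.log (residual X Z α₀ β₀ ε T k n i ω ^ 2)| := by
  have hC₀ := hD.nonneg
  obtain ⟨a, ha0, ha1, hinv⟩ := exists_residual_inverse_moment hε.meas hA4 k
  have habs := hε.average_rpow (hε.absMoment_lt_top 0 (t := 1) (by norm_num))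
  set E := Real.exp (q * (C₀ * ‖β₀‖)) with hE
  refine (hinv.sup (habs.sup hα)).of_imp fun C hC =>
    ⟨2 / a * (1 + (E * C + p * (C₀ * C)) + C), by positivity, ?_⟩
  filter_upwards [eventually_ge_atTop 1] with n hn
  refine Eventually.of_forall fun ω hle => ?_
  have hn1 : (1 : ℝ) ≤ n := by exact_mod_cast hn
  have hn0 : (0 : ℝ) < n := by linarith
  obtain ⟨h1, h2⟩ := sup_le_iff.1 hle
  obtain ⟨h2, h3⟩ := sup_le_iff.1 h2
  replace h1 := sum_le_of_average_le hn h1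
  replace h2 := sum_le_of_average_le hn h2
  simp only [Real.rpow_one] at h2
  have h4 : ‖alphaHat X Z α₀ β₀ ε T k n ω - α₀‖ ≤ C := by
    refine (le_mul_rpow_neg_of_rpow_mul_le hn h3).trans ?_
    exact mul_le_of_le_one_right hC
      (Real.rpow_le_one_of_one_le_of_nonpos hn1 (by norm_num))
  have h5 : ∑ i : Fin n, |residual X Z α₀ β₀ ε T k n i ω| ≤ (E * C + p * (C₀ * C)) * n := by
    calc ∑ i : Fin n, |residual X Z α₀ β₀ ε T k n i ω|
        ≤ ∑ i : Fin n, (E * |ε i ω| + p * (C₀ * C)) := by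
          refine Finset.sum_le_sum fun i _ => ?_
          rw [residual]
          refine (abs_sub _ _).trans (add_le_add ?_ ?_)
          · rw [abs_mul, Real.abs_exp]
            have : Real.exp (1 / 2 * (Z i ⬝ᵥ β₀)) ≤ E := Real.exp_le_exp.2
              ((le_abs_self _).trans (abs_half_dotProduct_le (hD.normZ i) le_rfl))
            gcongr
          · refine (abs_dotProduct_le _ _).trans ?_
            rw [Fintype.card_fin]
            have := hD.normX i
            gcongr
      _ = E * ∑ i : Fin n, |ε i ω| + n * (p * (C₀ * C)) := by
          rw [Finset.sum_add_distrib, ← Finset.mul_sum]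
          simp
      _ ≤ E * (C * n) + n * (p * (C₀ * C)) := by gcongr
      _ = _ := by ring
  have h6 := sum_abs_log_sq_le ha0 ha1.le _ h5 h1
  rw [← div_eq_inv_mul, div_le_iff₀ hn0]
  refine h6.trans_eq ?_
  ring

theorem coercive_zStar {n : ℕ} {κ : ℝ} (h : ∀ v : Fin (q + 1) → ℝ, κ * n * ‖v‖ ^ 2 ≤
      v ⬝ᵥ (((designMatrix (zStar Z) n)ᵀ * designMatrix (zStar Z) n) *ᵥ v))
    (v : Fin (q + 1) → ℝ) : κ * n * ‖v‖ ^ 2 ≤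
      v ⬝ᵥ (((designMatrix (zStar Z) n)ᵀ * diagonal (fun _ : Fin n => (1 : ℝ)) *
        designMatrix (zStar Z) n) *ᵥ v) := by
  simpa using coercive_gramForm (designMatrix (zStar Z) n) zero_le_one (fun _ => 1)
    (fun _ => le_rfl) h v

omit [IsProbabilityMeasure P] in
/-- The scale estimates are bounded in probability, whatever their tuning. -/
theorem betaStarHat_boundedInProb (hD : DesignBounds X Z κ C₀) (hε : NoiseRegular P ε)
    (hA4 : ResidualInverseMoments P X Z α₀ β₀ ε T) (homega : ∀ n j, 0 ≤ T.omega n j)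
    (hgam : ∀ n j, 0 ≤ T.gam n j) (k : ℕ)
    (hα : BoundedInProb P fun n ω =>
      (n : ℝ) ^ ((1 : ℝ) / 2) * ‖alphaHat X Z α₀ β₀ ε T k n ω - α₀‖) :
    BoundedInProb P fun n ω => ‖betaStarHat X Z α₀ β₀ ε T k n ω‖ := by
  have hC₀ := hD.nonneg
  have hκ := hD.pos
  refine (logResiduals_average hD hε hA4 k hα).of_imp fun C hC =>
    ⟨(q + 1) * (C₀ * C) / κ, by positivity, ?_⟩
  filter_upwards [eventually_ge_atTop 1, hD.coerciveZStar] with n hn hco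
  refine Eventually.of_forall fun ω hle => ?_
  have hn0 : (0 : ℝ) < n := by exact_mod_cast hn
  replace hle := sum_le_of_average_le hn hle
  set L := logRes X (fun i : Fin n => response X Z α₀ β₀ ε i ω)
    (alphaHat X Z α₀ β₀ ε T k n ω) with hL
  -- The initial ridge and the later steps are all adaptive ridge estimates, and the bound below
  -- depends neither on the penalty nor on the current estimate.
  obtain ⟨pen, b, hpen, hb⟩ : ∃ pen b : Fin (q + 1) → ℝ, (∀ j, 0 ≤ pen j) ∧
      betaStarHat X Z α₀ β₀ ε T k n ω =
        adaptiveRidge (designMatrix (zStar Z) n) (fun _ => 1) pen b L := by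
    cases k with
    | zero => exact ⟨_, _, homega n, ridge_eq_adaptiveRidge _ _ _⟩
    | succ k => exact ⟨_, _, hgam n, rfl⟩
  have h1 := norm_adaptiveRidge_le (designMatrix (zStar Z) n) (fun _ => 1) b L hpen
    (coercive_zStar hco)
  have h2 : ‖(designMatrix (zStar Z) n)ᵀ *ᵥ (diagonal (fun _ => (1 : ℝ)) *ᵥ L)‖ ≤
      C₀ * (C * n) := by
    rw [diagonal_one, one_mulVec]
    refine (norm_transpose_mulVec_le _ hC₀ (fun i j =>
      (norm_le_pi_norm (zStar Z i) j).trans (hD.normZStar i)) L).trans ?_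
    refine mul_le_mul_of_nonneg_left ?_ hC₀
    simpa only [hL, logRes_alphaHat_apply] using hle
  rw [hb, le_div_iff₀ hκ]
  refine le_of_mul_le_mul_right ?_ hn0
  calc _ = κ * n * ‖adaptiveRidge (designMatrix (zStar Z) n) (fun _ => 1) pen b L‖ := by ring
    _ ≤ (q + 1) * (C₀ * (C * n)) := by
        refine h1.trans ?_
        rw [Fintype.card_fin]
        push_cast
        gcongr
    _ = _ := by ring

omit [IsProbabilityMeasure P] in
theorem zStar_dotProduct_betaStar (i : ℕ) :
    zStar Z i ⬝ᵥ betaStar P ε β₀ = Z i ⬝ᵥ β₀ + logNoiseMean P ε := by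
  simp [dotProduct, Fin.sum_univ_castSucc, zStar, withOne, betaStar]

/-- The score of the second stage is of order `n ^ (1 - s/2)` if the noise has an inverse moment of
order larger than `s`. -/
theorem scale_stepBounds (hD : DesignBounds X Z κ C₀) (hε : NoiseRegular P ε)
    (hA4 : ResidualInverseMoments P X Z α₀ β₀ ε T) {s s' : ℝ} (hs0 : 0 < s) (hs1 : s ≤ 1)
    (hss : s < s') (hs' : absMoment P (ε 0) (-s') < ⊤) (k : ℕ)
    (hα : BoundedInProb P fun n ω =>
      (n : ℝ) ^ ((1 : ℝ) / 2) * ‖alphaHat X Z α₀ β₀ ε T k n ω - α₀‖) :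
    ∃ f : ℕ → Ω → ℝ, BoundedInProb P f ∧ ∀ C : ℝ, 0 ≤ C → ∃ κ' : ℝ, 0 < κ' ∧ ∃ K : ℝ, 0 ≤ K ∧
      ∀ᶠ n : ℕ in atTop, ∀ᵐ ω ∂P, f n ω ≤ C →
        StepBounds (designMatrix (zStar Z) n) (fun _ => 1)
          (fun i : Fin n => Real.log (residual X Z α₀ β₀ ε T k n i ω ^ 2) -
            zStar Z i ⬝ᵥ betaStar P ε β₀) s κ' K := by
  have hC₀ := hD.nonneg
  have hX : ∀ (i : ℕ) j, |zStar Z i j| ≤ C₀ := fun i j =>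
    (norm_le_pi_norm (zStar Z i) j).trans (hD.normZStar i)
  obtain ⟨a, ha0, ha1, hinv⟩ := exists_residual_inverse_moment hε.meas hA4 k
  have hεa := hε.average_rpow (hε.absMoment_lt_top 0 (t := -a) (by linarith))
  have hεs := hε.average_rpow hs'
  obtain ⟨V, hV, hscore⟩ := hε.whiteNoise_log.exists_score_bound hX hD.normZ
  -- A finite inverse moment excludes an atom of the noise at `0`, hence the conventional value of
  -- `log 0`.
  have hne : ∀ᵐ ω ∂P, ∀ i, ε i ω ≠ 0 := ae_all_iff.2 fun i =>
    ae_ne_zero_of_absMoment_lt_top (hε.meas i) (t := -(1 / 2)) (by norm_num)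
      (hε.absMoment_lt_top i (by norm_num))
  refine ⟨_, hinv.sup (hεa.sup (hεs.sup (hV.sup hα))), fun C hC => ?_⟩
  set D := (q : ℝ) * (C₀ * ‖β₀‖) with hDd
  set τ := Real.exp D * (p * (C₀ * C)) with hτ
  obtain ⟨B, hB0, hB⟩ := sum_abs_log_residual_sub_le (C := C) (τ := τ) (D := D) hs0 hs1 hss ha0
    (by positivity) hC (by positivity)
  set K₁ := C₀ * 1 * (((q + 1 : ℕ) : ℝ) * C₀) with hK₁
  set K₂ := C₀ * B + √C with hK₂
  have hK₁0 : 0 ≤ K₁ := by positivity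
  have hK₂0 : 0 ≤ K₂ := by positivity
  refine ⟨κ, hD.pos, K₁ + K₂, by positivity, ?_⟩
  filter_upwards [eventually_ge_atTop 1, hD.coerciveZStar] with n hn hco
  filter_upwards [hne] with ω hω hle
  have hn1 : (1 : ℝ) ≤ n := by exact_mod_cast hn
  simp only [sup_le_iff] at hle
  obtain ⟨h1, h2, h3, h4, h5⟩ := hle
  replace h1 := sum_le_of_average_le hn h1
  replace h2 := sum_le_of_average_le hn h2
  replace h3 := sum_le_of_average_le hn h3
  replace h5 := le_mul_rpow_neg_of_rpow_mul_le hn h5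
  refine ⟨coercive_zStar hco, fun v => ?_, ?_⟩
  · refine (norm_gramForm_mulVec_le (designMatrix (zStar Z) n) hC₀ zero_le_one
      (fun i j => hX i j) _ (fun _ => abs_one.le) v).trans ?_
    rw [Fintype.card_fin]
    gcongr
    exact le_add_of_nonneg_right hK₂0
  · set z : Fin n → ℝ := fun i => 1 / 2 * (Z i ⬝ᵥ β₀) with hz
    -- With the scale factored out, a residual is the error `ε i` shifted by `t i`, which is of
    -- order `n ^ (-1/2)`.
    set t : Fin n → ℝ := fun i => Real.exp (-z i) *
      (X i ⬝ᵥ (alphaHat X Z α₀ β₀ ε T k n ω - α₀)) with ht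
    have hzD : ∀ i, |z i| ≤ D := fun i => abs_half_dotProduct_le (hD.normZ i) le_rfl
    have hres : ∀ i : Fin n,
        residual X Z α₀ β₀ ε T k n i ω = Real.exp (z i) * (ε i ω - t i) := fun i => by
      rw [residual, mul_sub, ht, ← mul_assoc, ← Real.exp_add, add_neg_cancel, Real.exp_zero,
        one_mul]
    have htτ : ∀ i, |t i| ≤ τ * (n : ℝ) ^ (-(1 / 2) : ℝ) := by
      intro i
      have e1 : Real.exp (-z i) ≤ Real.exp D :=
        Real.exp_le_exp.2 ((neg_le_abs _).trans (hzD i))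
      have e2 : |X i ⬝ᵥ (alphaHat X Z α₀ β₀ ε T k n ω - α₀)| ≤
          p * (C₀ * (C * (n : ℝ) ^ (-(1 / 2) : ℝ))) := by
        refine (abs_dotProduct_le _ _).trans ?_
        rw [Fintype.card_fin]
        have := hD.normX i
        gcongr
      rw [ht, abs_mul, Real.abs_exp]
      calc _ ≤ Real.exp D * (p * (C₀ * (C * (n : ℝ) ^ (-(1 / 2) : ℝ)))) := by gcongr
        _ = _ := by rw [hτ]; ring
    simp only [hres] at h1
    have hsum := hB n hn (fun i => ε i ω) z t (fun i => hω i) hzD htτ h1 h2 h3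
    set Δ : Fin n → ℝ := fun i =>
      Real.log ((Real.exp (z i) * (ε i ω - t i)) ^ 2) - 2 * z i - Real.log (ε i ω ^ 2) with hΔ
    -- The white noise part carries no tilt, so the uniform score bound is used at `β = 0`.
    have hsplit : (designMatrix (zStar Z) n)ᵀ *ᵥ (diagonal (fun _ => (1 : ℝ)) *ᵥ
        fun i : Fin n => Real.log (residual X Z α₀ β₀ ε T k n i ω ^ 2) -
          zStar Z i ⬝ᵥ betaStar P ε β₀) = (designMatrix (zStar Z) n)ᵀ *ᵥ Δ +
        fun j => ∑ i : Fin n, zStar Z i j * (Real.log (ε i ω ^ 2) - logNoiseMean P ε) *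
          Real.exp (Z i ⬝ᵥ (0 : Fin q → ℝ)) := by
      funext j
      rw [Pi.add_apply, transpose_mul_diagonal_mulVec_apply, mulVec, dotProduct,
        ← Finset.sum_add_distrib]
      refine Finset.sum_congr rfl fun i _ => ?_
      rw [hres, zStar_dotProduct_betaStar, dotProduct_zero, Real.exp_zero, hΔ, hz, transpose_apply,
        designMatrix, of_apply]
      ring
    have hΔn : ‖(designMatrix (zStar Z) n)ᵀ *ᵥ Δ‖ ≤ C₀ * (B * (n : ℝ) ^ (1 - s / 2)) :=
      (norm_transpose_mulVec_le _ hC₀ (fun i j => hX i j) Δ).trans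
        (mul_le_mul_of_nonneg_left hsum hC₀)
    have hsq : √(n : ℝ) ≤ (n : ℝ) ^ (1 - s / 2) := by
      rw [Real.sqrt_eq_rpow]
      exact Real.rpow_le_rpow_of_exponent_le hn1 (by linarith)
    have hVn : √(n : ℝ) * √(Real.exp ((0 : Fin q → ℝ) ⬝ᵥ 0) * V n ω) ≤
        (n : ℝ) ^ (1 - s / 2) * √C := by
      rw [dotProduct_zero, Real.exp_zero, one_mul]
      gcongr
    rw [hsplit]
    calc _ ≤ C₀ * (B * (n : ℝ) ^ (1 - s / 2)) + (n : ℝ) ^ (1 - s / 2) * √C :=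
          (norm_add_le _ _).trans (add_le_add hΔn ((hscore n ω 0).trans hVn))
      _ = K₂ * (n : ℝ) ^ (1 - s / 2) := by rw [hK₂]; ring
      _ ≤ _ := by
          gcongr
          linarith

omit [IsProbabilityMeasure P] in
/-- Rate of a ridge estimate. -/
theorem ridge_rate {m : Type*} [Fintype m] [DecidableEq m] {X : ∀ n, Matrix (Fin n) m ℝ}
    {e y : ∀ n, Ω → Fin n → ℝ} {pen : ℕ → m → ℝ} {θ : m → ℝ} {f : ℕ → Ω → ℝ} {s : ℝ}
    (hs1 : s ≤ 1) (hf : BoundedInProb P f)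
    (hstep : ∀ C : ℝ, 0 ≤ C → ∃ κ : ℝ, 0 < κ ∧ ∃ K : ℝ, 0 ≤ K ∧ ∀ᶠ n in atTop, ∀ᵐ ω ∂P,
      f n ω ≤ C → StepBounds (X n) (fun _ => 1) (e n ω) s κ K)
    (hy : ∀ n ω i, y n ω i = (X n *ᵥ θ) i + e n ω i) (hpos : ∀ n j, 0 ≤ pen n j)
    (hpen : SqrtNegligible pen) :
    BoundedInProb P fun n ω => (n : ℝ) ^ (s / 2) * ‖ridge (X n) (pen n) (y n ω) - θ‖ := by
  refine hf.of_imp fun C hC => ?_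
  obtain ⟨κ, hκ, K, hK, hev⟩ := hstep C hC
  refine ⟨Fintype.card m * (K + ‖θ‖ / 1 ^ 2) / κ, by positivity, ?_⟩
  filter_upwards [hev, eventually_ge_atTop 1, hpen.eventually_le] with n h1 hn h2
  filter_upwards [h1] with ω h3 hle
  rw [ridge_eq_adaptiveRidge]
  exact (h3 hle).rate hn hs1 hκ one_pos (hy n ω) (hpos n) h2 (fun _ => Or.inl one_ne_zero)
    (fun _ _ => abs_one.ge)

/-- The step of the location estimates, given bounded scale estimates. -/
theorem alphaHat_step (hD : DesignBounds X Z κ C₀) (hε : NoiseRegular P ε)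
    (hlam : ∀ n j, 0 < T.lam n j) (hlam0 : SqrtNegligible T.lam) (k : ℕ)
    (hα : BoundedInProb P fun n ω =>
      (n : ℝ) ^ ((1 : ℝ) / 2) * ‖alphaHat X Z α₀ β₀ ε T k n ω - α₀‖)
    (hβ : BoundedInProb P fun n ω => ‖betaStarHat X Z α₀ β₀ ε T k n ω‖) :
    (BoundedInProb P fun n ω =>
      (n : ℝ) ^ ((1 : ℝ) / 2) * ‖alphaHat X Z α₀ β₀ ε T (k + 1) n ω - α₀‖) ∧
    (Tendsto (fun n : ℕ => (⨅ j, T.lam n j) / (n : ℝ) ^ (1 - (1 : ℝ))) atTop atTop →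
      TendstoInMeasure P (fun n ω => zeroNorm α₀ (alphaHat X Z α₀ β₀ ε T (k + 1) n ω) /
        zeroNorm α₀ (alphaHat X Z α₀ β₀ ε T k n ω)) atTop fun _ => (0 : ℝ)) := by
  obtain ⟨V, hV, hstep⟩ := exists_location_stepBounds hD hε β₀
  refine adaptiveRidge_step (X := designMatrix X)
    (w := fun n ω => scalePow Z (Fin.init (betaStarHat X Z α₀ β₀ ε T k n ω)) (-2) n)
    (e := fun n ω i => Real.exp (1 / 2 * (Z i ⬝ᵥ β₀)) * ε i ω)
    (y := fun n ω i => response X Z α₀ β₀ ε i ω) one_pos le_rfl (hβ.sup hV) (fun C hC => ?_)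
    (fun _ _ _ => rfl) (fun _ _ => rfl) hα (Eventually.of_forall hlam) hlam0
  obtain ⟨κ', hκ', K, hK, hev⟩ := hstep C hC
  refine ⟨κ', hκ', K, hK, ?_⟩
  filter_upwards [hev] with n hn
  refine Eventually.of_forall fun ω hle => ?_
  exact hn ω _ ((norm_init_le _).trans (sup_le_iff.1 hle).1) (sup_le_iff.1 hle).2

/-- Root-`n` consistency of the location estimates and boundedness of the scale estimates. -/
theorem alphaHat_rate (hD : DesignBounds X Z κ C₀) (hε : NoiseRegular P ε)
    (hA4 : ResidualInverseMoments P X Z α₀ β₀ ε T) (hpsi : ∀ n j, 0 ≤ T.psi n j)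
    (homega : ∀ n j, 0 ≤ T.omega n j) (hlam : ∀ n j, 0 < T.lam n j)
    (hgam : ∀ n j, 0 ≤ T.gam n j) (hpsi0 : SqrtNegligible T.psi)
    (hlam0 : SqrtNegligible T.lam) (k : ℕ) :
    BoundedInProb P fun n ω =>
      (n : ℝ) ^ ((1 : ℝ) / 2) * ‖alphaHat X Z α₀ β₀ ε T k n ω - α₀‖ := by
  induction k with
  | zero =>
    obtain ⟨V, hV, hstep⟩ := exists_location_stepBounds hD hε β₀
    refine ridge_rate (X := designMatrix X)
      (e := fun n ω i => Real.exp (1 / 2 * (Z i ⬝ᵥ β₀)) * ε i ω)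
      (y := fun n ω i => response X Z α₀ β₀ ε i ω) le_rfl hV (fun C hC => ?_)
      (fun _ _ _ => rfl) hpsi hpsi0
    obtain ⟨κ', hκ', K, hK, hev⟩ := hstep C hC
    refine ⟨κ', hκ', K, hK, ?_⟩
    filter_upwards [hev] with n hn
    refine Eventually.of_forall fun ω hle => ?_
    have hw : (fun _ => 1 : Fin n → ℝ) = scalePow Z 0 (-2) n := by
      funext i
      simp [scalePow]
    rw [hw]
    exact hn ω 0 (by simpa using hC) hle
  | succ k ih =>
    -- The rate at `k` bounds the scale estimate at `k`, which is all that the next location step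
    -- requires.
    exact (alphaHat_step hD hε hlam hlam0 k ih
      (betaStarHat_boundedInProb hD hε hA4 homega hgam k ih)).1

/-- The step of the scale estimates. -/
theorem betaStarHat_step (hD : DesignBounds X Z κ C₀) (hε : NoiseRegular P ε)
    (hA4 : ResidualInverseMoments P X Z α₀ β₀ ε T) {s s' : ℝ} (hs0 : 0 < s) (hs1 : s ≤ 1)
    (hss : s < s') (hs' : absMoment P (ε 0) (-s') < ⊤)
    (hgam : ∀ᶠ n in atTop, ∀ j, 0 < T.gam n j) (hgam0 : SqrtNegligible T.gam) (k : ℕ)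
    (hα : BoundedInProb P fun n ω =>
      (n : ℝ) ^ ((1 : ℝ) / 2) * ‖alphaHat X Z α₀ β₀ ε T (k + 1) n ω - α₀‖)
    (hβ : BoundedInProb P fun n ω =>
      (n : ℝ) ^ (s / 2) * ‖betaStarHat X Z α₀ β₀ ε T k n ω - betaStar P ε β₀‖) :
    (BoundedInProb P fun n ω =>
      (n : ℝ) ^ (s / 2) * ‖betaStarHat X Z α₀ β₀ ε T (k + 1) n ω - betaStar P ε β₀‖) ∧
    (Tendsto (fun n : ℕ => (⨅ j, T.gam n j) / (n : ℝ) ^ (1 - s)) atTop atTop →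
      TendstoInMeasure P (fun n ω =>
        zeroNorm (betaStar P ε β₀) (betaStarHat X Z α₀ β₀ ε T (k + 1) n ω) /
        zeroNorm (betaStar P ε β₀) (betaStarHat X Z α₀ β₀ ε T k n ω)) atTop
        fun _ => (0 : ℝ)) := by
  -- The step from `k` to `k + 1` uses the residuals of the already updated location estimate, hence
  -- the index `k + 1`.
  obtain ⟨f, hf, hstep⟩ := scale_stepBounds hD hε hA4 hs0 hs1 hss hs' (k + 1) hα
  refine adaptiveRidge_step (X := designMatrix (zStar Z)) (w := fun n ω _ => 1)
    (y := fun n ω => logRes X (fun i : Fin n => response X Z α₀ β₀ ε i ω)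
      (alphaHat X Z α₀ β₀ ε T (k + 1) n ω)) hs0 hs1 hf hstep (fun n ω i => ?_)
    (fun _ _ => rfl) hβ hgam hgam0
  rw [logRes_alphaHat_apply]
  exact (add_sub_cancel _ _).symm

/-- Consistency of the scale estimates at the rate `n ^ (-s/2)`. -/
theorem betaStarHat_rate (hD : DesignBounds X Z κ C₀) (hε : NoiseRegular P ε)
    (hA4 : ResidualInverseMoments P X Z α₀ β₀ ε T) {s s' : ℝ} (hs0 : 0 < s) (hs1 : s ≤ 1)
    (hss : s < s') (hs' : absMoment P (ε 0) (-s') < ⊤)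
    (homega : ∀ n j, 0 ≤ T.omega n j) (homega0 : SqrtNegligible T.omega)
    (hgam : ∀ᶠ n in atTop, ∀ j, 0 < T.gam n j) (hgam0 : SqrtNegligible T.gam)
    (hα : ∀ k, BoundedInProb P fun n ω =>
      (n : ℝ) ^ ((1 : ℝ) / 2) * ‖alphaHat X Z α₀ β₀ ε T k n ω - α₀‖) (k : ℕ) :
    BoundedInProb P fun n ω =>
      (n : ℝ) ^ (s / 2) * ‖betaStarHat X Z α₀ β₀ ε T k n ω - betaStar P ε β₀‖ := by
  induction k with
  | zero =>
    obtain ⟨f, hf, hstep⟩ := scale_stepBounds hD hε hA4 hs0 hs1 hss hs' 0 (hα 0)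
    refine ridge_rate (X := designMatrix (zStar Z))
      (y := fun n ω => logRes X (fun i : Fin n => response X Z α₀ β₀ ε i ω)
        (alphaHat X Z α₀ β₀ ε T 0 n ω)) hs1 hf hstep (fun n ω i => ?_) homega homega0
    rw [logRes_alphaHat_apply]
    exact (add_sub_cancel _ _).symm
  | succ k ih =>
    exact (betaStarHat_step hD hε hA4 hs0 hs1 hss hs' hgam hgam0 k (hα (k + 1)) ih).1

omit [IsProbabilityMeasure P] in
/-- The orders `s < s'` of inverse moments of the noise that match the growth of the penalties. -/
theorem exists_inverse_moment_orders (hε : NoiseRegular P ε) (hgam : ∀ n j, 0 ≤ T.gam n j)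
    (h : (∃ c : ℝ, 0 < c ∧ Tendsto (fun n : ℕ => (⨅ j, T.gam n j) / (n : ℝ) ^ c) atTop atTop) ∨
      ((∃ τ : ℝ, 0 < τ ∧ absMoment P (ε 0) (-(1 + τ)) < ⊤) ∧
        Tendsto (fun n => ⨅ j, T.gam n j) atTop atTop)) :
    ∃ s s' : ℝ, 0 < s ∧ s ≤ 1 ∧ s < s' ∧ absMoment P (ε 0) (-s') < ⊤ ∧
      Tendsto (fun n : ℕ => (⨅ j, T.gam n j) / (n : ℝ) ^ (1 - s)) atTop atTop := by
  rcases h with ⟨c, hc, h⟩ | ⟨⟨τ, hτ, hmom⟩, h⟩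
  -- With `s = 1 - d` the loss `n ^ (1 - s) = n ^ d` is at most `n ^ c`, and `s' = 1 - d / 2` lies
  -- strictly between `s` and `1`; the cap `1/2` keeps `s` positive.
  · set d := min c (1 / 2) with hd
    have hd0 : 0 < d := lt_min hc (by norm_num)
    have hd1 : d ≤ 1 / 2 := min_le_right _ _
    refine ⟨1 - d, 1 - d / 2, by linarith, by linarith, by linarith,
      hε.moments _ (by linarith), ?_⟩
    refine tendsto_atTop_mono' _ ?_ h
    filter_upwards [eventually_ge_atTop 1] with n hn
    have hn1 : (1 : ℝ) ≤ n := by exact_mod_cast hn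
    have hinf : 0 ≤ ⨅ j, T.gam n j := Real.iInf_nonneg (hgam n)
    rw [sub_sub_cancel]
    gcongr
    exact min_le_left _ _
  · exact ⟨1, 1 + τ, one_pos, le_rfl, by linarith, hmom, by simpa using h⟩

/-- The scale penalties are only assumed nonnegative; their divergence supplies the eventual
positivity that `betaStarHat_step` asks for. -/
theorem eventually_pos_of_tendsto_iInf {s : ℝ}
    (h : Tendsto (fun n : ℕ => (⨅ j, T.gam n j) / (n : ℝ) ^ (1 - s)) atTop atTop) :
    ∀ᶠ n in atTop, ∀ j, 0 < T.gam n j := by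
  filter_upwards [h.eventually_gt_atTop 0, eventually_ge_atTop 1] with n hn hn1 j
  have hn0 : (0 : ℝ) < n := by exact_mod_cast hn1
  have h1 := mul_pos hn (show 0 < (n : ℝ) ^ (1 - s) by positivity)
  rw [div_mul_cancel₀ _ (by positivity)] at h1
  exact h1.trans_le (ciInf_le (Set.finite_range _).bddBelow j)

end Model

end HetAR

theorem theorem3 {Ω : Type*} [MeasurableSpace Ω] (P : Measure Ω) [IsProbabilityMeasure P]
    {p q : ℕ} (X : ℕ → Fin p → ℝ) (Z : ℕ → Fin q → ℝ)
    (α₀ : Fin p → ℝ) (β₀ : Fin q → ℝ) (ε : ℕ → Ω → ℝ) (T : HetAR.Tuning p q)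
    (Θ : Set (Fin q → ℝ)) (hΘ : Bornology.IsBounded Θ) (hβ₀ : β₀ ∈ Θ)
    (hA1 : HetAR.DesignRegular X Z β₀ Θ)
    (hA2 : HetAR.BoundedDesign X Z)
    (hA3 : HetAR.NoiseRegular P ε)
    (hA4 : HetAR.ResidualInverseMoments P X Z α₀ β₀ ε T)
    (hpsi : ∀ n j, 0 ≤ T.psi n j) (homega : ∀ n j, 0 ≤ T.omega n j)
    (hlam : ∀ n j, 0 < T.lam n j) (hgam : ∀ n j, 0 ≤ T.gam n j)
    (hpsi0 : HetAR.SqrtNegligible T.psi) (hlam0 : HetAR.SqrtNegligible T.lam) :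
    (Tendsto (fun n => ⨅ j, T.lam n j) atTop atTop →
      ∀ k : ℕ, TendstoInMeasure P
        (fun n ω => HetAR.zeroNorm α₀ (HetAR.alphaHat X Z α₀ β₀ ε T (k + 1) n ω) /
          HetAR.zeroNorm α₀ (HetAR.alphaHat X Z α₀ β₀ ε T k n ω))
        atTop (fun _ => (0 : ℝ))) ∧
    (HetAR.SqrtNegligible T.omega → HetAR.SqrtNegligible T.gam →
      ((∃ c : ℝ, 0 < c ∧ Tendsto (fun n : ℕ => (⨅ j, T.gam n j) / (n : ℝ) ^ c) atTop atTop) ∨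
        ((∃ τ : ℝ, 0 < τ ∧ HetAR.absMoment P (ε 0) (-(1 + τ)) < ⊤) ∧
          Tendsto (fun n => ⨅ j, T.gam n j) atTop atTop)) →
      ∀ k : ℕ, TendstoInMeasure P
        (fun n ω =>
          HetAR.zeroNorm (HetAR.betaStar P ε β₀) (HetAR.betaStarHat X Z α₀ β₀ ε T (k + 1) n ω) /
          HetAR.zeroNorm (HetAR.betaStar P ε β₀) (HetAR.betaStarHat X Z α₀ β₀ ε T k n ω))
        atTop (fun _ => (0 : ℝ))) := by
  obtain ⟨κ, C, hD⟩ := hA1.exists_designBounds hA2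
  have hα := HetAR.alphaHat_rate hD hA3 hA4 hpsi homega hlam hgam hpsi0 hlam0
  refine ⟨fun hmin k => ?_, fun homega0 hgam0 hmin k => ?_⟩
  · have hβ := HetAR.betaStarHat_boundedInProb hD hA3 hA4 homega hgam k (hα k)
    exact (HetAR.alphaHat_step hD hA3 hlam hlam0 k (hα k) hβ).2 (by simpa using hmin)
  · obtain ⟨s, s', hs0, hs1, hss, hs', hmin'⟩ :=
      HetAR.exists_inverse_moment_orders hA3 hgam hmin
    have hpos := HetAR.eventually_pos_of_tendsto_iInf hmin'
    have hβ := HetAR.betaStarHat_rate hD hA3 hA4 hs0 hs1 hss hs' homega homega0 hpos hgam0 hα k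
    exact (HetAR.betaStarHat_step hD hA3 hA4 hs0 hs1 hss hs' hpos hgam0 k (hα (k + 1)) hβ).2 hmin'
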